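/- For $f:\mathbb Z\to\mathbb R$ let $\delta_{right}f(n)=f(n)-f(n+1)$, $n\in\mathbb Z$, and let $$e^{t\Delta_d}f(n)=\sum_{j\in\mathbb Z}G(t,n-j)f(j),\qquad G(t,n)=e^{-2t}I_n(2t),\qquad t>0,\ n\in\mathbb Z,$$ be the heat semigroup of the discrete Laplacian $\Delta_d f(n)=f(n+1)-2f(n)+f(n-1)$, where $I_n(t)=\sum_{m=0}^\infty\frac{1}{m!\,\Gamma(m+n+1)}\left(\frac t2\right)^{2m+n}$ for integers $n\ge 0$ and $I_{-n}=I_n$ are the modified Bessel functions of the first kind. Let $\mu$ be the measure on $\mathbb Z$ with $\mu(\{n\})=\frac1{1+|n|}$. For $1\le p,q\le\infty$ and $F(t,n)$, $t>0$, $n\in\mathbb Z$, put $$\|F\|_{p,q}=\left(\int_0^\infty\|F(t,\cdot)\|_{\ell^p(\mathbb Z)}^q\,\frac{dt}{t}\right)^{1/q}\quad(q<\infty),\qquad \|F\|_{p,\infty}=\operatorname*{ess\,sup}_{t>0}\|F(t,\cdot)\|_{\ell^p(\mathbb Z)}.$$ For $\alpha>0$ and $1\le p,q\le\infty$, let $\Lambda_H^{\alpha,p,q}$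 be the set of all $f:\mathbb Z\to\mathbb R$ such that $$\frac{f}{1+|\cdot|^\alpha}\in\ell^q(\mathbb Z,\mu)\quad\text{and}\quad\left\|t^{k-\frac\alpha2}\,\partial_t^k e^{t\Delta_d}f\right\|_{p,q}<\infty,\qquad\text{where } k=\left[\tfrac\alpha2\right]+1$$ and $[\cdot]$ denotes the integer part. **Theorem.** Let $\alpha>1$, $1\le p,q\le\infty$ and $f:\mathbb Z\to\mathbb R$. Then $f\in\Lambda_H^{\alpha,p,q}$ if and only if $\delta_{right}f\in\Lambda_H^{\alpha-1,p,q}$. -/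

import Mathlib

open MeasureTheory Set
open scoped ENNReal

noncomputable section

namespace DiscreteBesov

/-- The discrete derivative from the right, `δ_right f(n) = f(n) - f(n+1)`. -/
def deltaRight (f : ℤ → ℝ) : ℤ → ℝ := fun n => f n - f (n + 1)

/-- The modified Bessel function of the first kind of integer order,
`I_n(t) = ∑ₘ (t/2)^(2m+n) / (m! Γ(m+n+1))` for `n ≥ 0`, and `I_{-n} = I_n`. -/
def besselI (n : ℤ) (t : ℝ) : ℝ :=
  ∑' m : ℕ, (t / 2) ^ (2 * m + n.natAbs) /
    ((m.factorial : ℝ) * Real.Gamma ((m : ℝ) + (n.natAbs : ℝ) + 1))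

/-- The discrete heat kernel `G(t,n) = e^{-2t} I_n(2t)`. -/
def heatKernel (t : ℝ) (n : ℤ) : ℝ := Real.exp (-2 * t) * besselI n (2 * t)

/-- The discrete heat semigroup `e^{tΔ_d} f(n) = ∑_j G(t,n-j) f(j)`. -/
def heatSemigroup (t : ℝ) (f : ℤ → ℝ) (n : ℤ) : ℝ := ∑' j : ℤ, heatKernel t (n - j) * f j

/-- The measure `μ = ∑_n (1+|n|)⁻¹ δ_n` on `ℤ`. -/
def weightMeasure : Measure ℤ :=
  Measure.sum fun n : ℤ => ENNReal.ofReal (1 / (1 + |(n : ℝ)|)) • Measure.dirac n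

/-- The measure `dt/t` on `(0,∞)`. -/
def dtOverT : Measure ℝ :=
  (volume.restrict (Ioi (0 : ℝ))).withDensity fun t => ENNReal.ofReal (1 / t)

/-- The mixed norm of `L^q((0,∞), dt/t; ℓ^p(ℤ))`, as an extended nonnegative real: the `L^q(dt/t)`
norm (essential supremum for `q = ∞`) of `t ↦ ‖F(t)‖_{ℓ^p(ℤ)}`. -/
def mixedNorm (p q : ℝ≥0∞) (F : ℝ → ℤ → ℝ) : ℝ≥0∞ :=
  eLpNorm (fun t : ℝ => eLpNorm (F t) p (Measure.count : Measure ℤ)) q dtOverT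

/-- The discrete heat Besov space `Λ_H^{α,p,q}`: the functions `f` with
`f/(1+|·|^α) ∈ ℓ^q(ℤ,μ)` and `‖t^{k-α/2} ∂_t^k e^{tΔ_d} f‖_{p,q} < ∞`, where `k = [α/2]+1`.
The first condition makes the series defining the semigroup absolutely convergent. -/
def LambdaH (α : ℝ) (p q : ℝ≥0∞) : Set (ℤ → ℝ) :=
  {f | MemLp (fun n : ℤ => f n / (1 + |(n : ℝ)| ^ α)) q weightMeasure ∧
    mixedNorm p q (fun t n =>
      t ^ (((⌊α / 2⌋₊ + 1 : ℕ) : ℝ) - α / 2) *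
        iteratedDeriv (⌊α / 2⌋₊ + 1) (fun s : ℝ => heatSemigroup s f n) t) < ∞}

end DiscreteBesov

end

/-! Up to a translation, Δ_d is δ_right², and both operators commute with the heat semigroup. By the
heat equation, ‖∂_t^k e^{tΔ_d} f‖_p therefore equals ‖e^{tΔ_d} δ_right^{2k} f‖_p. Both seminorms in
the theorem then belong to one family, `besovNorm l α p q f`, built from t^{(l-α)/2} ‖e^{tΔ_d}
δ_right^l f‖_p: f uses an even l, and δ_right f an odd one. Under the growth condition, finiteness
is the same for all l > α. Going up (`besovNorm_succ_lt_top`) uses the gradient bound ‖δ_right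
e^{tΔ_d} g‖_p ≤ C t^{-1/2} ‖g‖_p and the semigroup law. Going down (`besovNorm_lt_top_of_add_two`)
integrates the heat equation from t to ∞, which removes two differences; the required decay at
infinity comes from the growth condition.

The growth condition passes from δ_right f to f by summation, a discrete Hardy inequality. The
converse needs the seminorm (`eLpNorm_growthFun_deltaRight`): s ↦ e^{sΔ_d} δ_right f(n) is Taylor
expanded at s = (1+|n|)² and evaluated at s = 0. The terms of the polynomial are averages of f at
scale 1+|n|, and the integral remainder is controlled by the seminorm.

All these integral inequalities are Schur tests with the kernels min(x/y, y/x)^a: dt/t in the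
variable √t and μ in the variable 1+|n| both behave like dρ/ρ (`LogSize`).

The kernel bounds are probabilistic. The Bessel series regroups so that e^{tΔ_d} averages f over the
difference of two independent Poisson variables of mean t. Differencing inserts the factor a/t - 1,
whose first absolute moment is of order t^{-1/2}; exponential tilting adds off-diagonal decay. -/

namespace DiscreteBesov

/-! ### Jensen, Schur and Minkowski inequalities in `ℝ≥0∞` -/

section Inequalities

variable {X Y : Type*} [MeasurableSpace X] [MeasurableSpace Y]

/-- Jensen's inequality for a weighted integral. -/
theorem lintegral_mul_rpow_le {ν : Measure Y} {q : ℝ} (hq : 1 ≤ q) {K h : Y → ℝ≥0∞}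
    (hK : AEMeasurable K ν) (hh : AEMeasurable h ν) :
    (∫⁻ y, K y * h y ∂ν) ^ q ≤ (∫⁻ y, K y ∂ν) ^ (q - 1) * ∫⁻ y, K y * h y ^ q ∂ν := by
  rcases hq.eq_or_lt with rfl | hq
  · simp
  have hq0 : 0 < q := by linarith
  have hc : (Real.conjExponent q).HolderConjugate q := (Real.HolderConjugate.conjExponent hq).symm
  set r := Real.conjExponent q with hr
  have hr0 : 0 < r := hc.pos
  have hsum : 1 / r + 1 / q = 1 := by simpa [one_div] using hc.inv_add_inv_eq_one
  have hqr : q / r = q - 1 := by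
    have := hsum; field_simp at this ⊢; linarith
  -- Hölder for the splitting K h = K^{1/r} · (K^{1/q} h), with r conjugate to q.
  have h1 := ENNReal.lintegral_mul_le_Lp_mul_Lq ν hc (f := fun y => K y ^ (1 / r))
    (g := fun y => K y ^ (1 / q) * h y) (hK.pow_const _) ((hK.pow_const _).mul hh)
  have h2 : ∀ y, K y ^ (1 / r) * (K y ^ (1 / q) * h y) = K y * h y := by
    intro y
    rw [← mul_assoc, ← ENNReal.rpow_add_of_nonneg _ _ (by positivity) (by positivity), hsum,
      ENNReal.rpow_one]
  have h3 : ∀ y, (K y ^ (1 / r)) ^ r = K y := by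
    intro y; rw [← ENNReal.rpow_mul, one_div_mul_cancel hr0.ne', ENNReal.rpow_one]
  have h4 : ∀ y, (K y ^ (1 / q) * h y) ^ q = K y * h y ^ q := by
    intro y
    rw [ENNReal.mul_rpow_of_nonneg _ _ hq0.le, ← ENNReal.rpow_mul, one_div_mul_cancel hq0.ne',
      ENNReal.rpow_one]
  simp only [Pi.mul_apply, h2, h3, h4] at h1
  calc (∫⁻ y, K y * h y ∂ν) ^ q
      ≤ ((∫⁻ y, K y ∂ν) ^ (1 / r) * (∫⁻ y, K y * h y ^ q ∂ν) ^ (1 / q)) ^ q := by gcongr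
    _ = _ := by
      rw [ENNReal.mul_rpow_of_nonneg _ _ hq0.le, ← ENNReal.rpow_mul, ← ENNReal.rpow_mul,
        one_div_mul_cancel hq0.ne', ENNReal.rpow_one, one_div_mul_eq_div, hqr]

/-- Schur's test. -/
theorem eLpNorm_lintegral_kernel_le {μ : Measure X} {ν : Measure Y} [SFinite μ] [SFinite ν]
    {q : ℝ≥0∞} (hq : 1 ≤ q) {K : X → Y → ℝ≥0∞} (hK : Measurable (Function.uncurry K))
    {A : ℝ≥0∞} (hA : ∀ᵐ x ∂μ, ∫⁻ y, K x y ∂ν ≤ A) (hB : ∀ᵐ y ∂ν, ∫⁻ x, K x y ∂μ ≤ A)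
    {h : Y → ℝ≥0∞} (hh : Measurable h) :
    eLpNorm (fun x => ∫⁻ y, K x y * h y ∂ν) q μ ≤ A * eLpNorm h q ν := by
  have hKx : ∀ x, Measurable (K x) := fun x => hK.comp measurable_prodMk_left
  rcases eq_or_ne q ∞ with rfl | hq'
  · rw [eLpNorm_exponent_top, eLpNorm_exponent_top]
    refine eLpNormEssSup_le_of_ae_enorm_bound ?_
    filter_upwards [hA] with x hx
    rw [enorm_eq_self]
    calc ∫⁻ y, K x y * h y ∂ν ≤ ∫⁻ y, K x y * eLpNormEssSup h ν ∂ν := by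
          refine lintegral_mono_ae ?_
          filter_upwards [enorm_ae_le_eLpNormEssSup h ν] with y hy
          rw [enorm_eq_self] at hy
          gcongr
      _ = (∫⁻ y, K x y ∂ν) * eLpNormEssSup h ν := lintegral_mul_const _ (hKx x)
      _ ≤ _ := by gcongr
  · have hq0 : q ≠ 0 := (zero_lt_one.trans_le hq).ne'
    have hqr : 1 ≤ q.toReal := by
      simpa using (ENNReal.toReal_le_toReal ENNReal.one_ne_top hq').2 hq
    have hqp : 0 < q.toReal := by linarith
    rw [eLpNorm_eq_lintegral_rpow_enorm_toReal hq0 hq', eLpNorm_eq_lintegral_rpow_enorm_toReal hq0 hq']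
    simp only [enorm_eq_self]
    set s := q.toReal
    -- Jensen in y with row mass at most A costs A^{s-1}; after Tonelli the column mass costs one
    -- more A.
    have key : ∫⁻ x, (∫⁻ y, K x y * h y ∂ν) ^ s ∂μ ≤ A ^ s * ∫⁻ y, h y ^ s ∂ν := by
      calc ∫⁻ x, (∫⁻ y, K x y * h y ∂ν) ^ s ∂μ
          ≤ ∫⁻ x, A ^ (s - 1) * ∫⁻ y, K x y * h y ^ s ∂ν ∂μ := by
            refine lintegral_mono_ae ?_
            filter_upwards [hA] with x hx
            refine (lintegral_mul_rpow_le hqr (hKx x).aemeasurable hh.aemeasurable).trans ?_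
            gcongr
        _ = A ^ (s - 1) * ∫⁻ x, ∫⁻ y, K x y * h y ^ s ∂ν ∂μ := by
            refine lintegral_const_mul _ ?_
            exact Measurable.lintegral_prod_right'
              (f := fun z : X × Y => K z.1 z.2 * h z.2 ^ s)
              (hK.mul ((hh.comp measurable_snd).pow_const _))
        _ = A ^ (s - 1) * ∫⁻ y, (∫⁻ x, K x y ∂μ) * h y ^ s ∂ν := by
            rw [lintegral_lintegral_swap]
            · congr 1
              refine lintegral_congr fun y => ?_
              rw [lintegral_mul_const]
              exact hK.comp measurable_prodMk_right
            · exact (hK.mul ((hh.comp measurable_snd).pow_const _)).aemeasurable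
        _ ≤ A ^ (s - 1) * ∫⁻ y, A * h y ^ s ∂ν := by
            refine mul_le_mul' le_rfl (lintegral_mono_ae ?_)
            filter_upwards [hB] with y hy
            gcongr
        _ = A ^ s * ∫⁻ y, h y ^ s ∂ν := by
            rw [lintegral_const_mul _ (hh.pow_const _), ← mul_assoc]
            congr 1
            conv_lhs => rw [← ENNReal.rpow_one A, ← ENNReal.rpow_mul, one_mul]
            rw [← ENNReal.rpow_add_of_nonneg _ _ (by linarith) zero_le_one]
            simp
    calc (∫⁻ x, (∫⁻ y, K x y * h y ∂ν) ^ s ∂μ) ^ (1 / s)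
        ≤ (A ^ s * ∫⁻ y, h y ^ s ∂ν) ^ (1 / s) := by gcongr
      _ = _ := by
        rw [ENNReal.mul_rpow_of_nonneg _ _ (by positivity), ← ENNReal.rpow_mul,
          mul_one_div_cancel hqp.ne', ENNReal.rpow_one]

/-- Measurability of the `ℓ^p(ℤ)` norm with respect to a parameter. -/
theorem measurable_eLpNorm_count {ι : Type*} [MeasurableSpace ι] [Countable ι]
    [MeasurableSingletonClass ι] {p : ℝ≥0∞} (hp : p ≠ 0)
    {F : Y → ι → ℝ≥0∞} (hF : ∀ n, Measurable fun s => F s n) :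
    Measurable fun s => eLpNorm (F s) p (Measure.count : Measure ι) := by
  rcases eq_or_ne p ∞ with rfl | hp'
  · simp only [eLpNorm_exponent_top, eLpNormEssSup_count, enorm_eq_self]
    exact Measurable.iSup hF
  · simp only [eLpNorm_eq_lintegral_rpow_enorm_toReal hp hp', enorm_eq_self, lintegral_count]
    exact (Measurable.tsum fun n => (hF n).pow_const _).pow_const _

/-- Minkowski's integral inequality in `ℓ^p`. -/
theorem eLpNorm_count_lintegral_le {ι : Type*} [MeasurableSpace ι] [Countable ι]
    [MeasurableSingletonClass ι] {ν : Measure Y}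
    {p : ℝ≥0∞} (hp : 1 ≤ p) {F : Y → ι → ℝ≥0∞} (hF : ∀ n, Measurable fun s => F s n) :
    eLpNorm (fun n => ∫⁻ s, F s n ∂ν) p (Measure.count : Measure ι) ≤
      ∫⁻ s, eLpNorm (F s) p (Measure.count : Measure ι) ∂ν := by
  have hp0 : p ≠ 0 := (zero_lt_one.trans_le hp).ne'
  set w : Y → ℝ≥0∞ := fun s => eLpNorm (F s) p (Measure.count : Measure ι) with hw
  have hwm : Measurable w := measurable_eLpNorm_count hp0 hF
  have hFw : ∀ s n, F s n ≤ w s := fun s n => by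
    simpa using enorm_le_eLpNorm_count (F s) n hp0
  rcases eq_or_ne p ∞ with rfl | hp'
  · rw [eLpNorm_exponent_top, eLpNormEssSup_count]
    refine iSup_le fun n => ?_
    rw [enorm_eq_self]
    exact lintegral_mono fun s => hFw s n
  rcases eq_or_ne (∫⁻ s, w s ∂ν) ∞ with htop | htop
  · rw [htop]; exact le_top
  have hpr : 1 ≤ p.toReal := by
    simpa using (ENNReal.toReal_le_toReal ENNReal.one_ne_top hp').2 hp
  have hpp : 0 < p.toReal := by linarith
  have hwfin : ∀ᵐ s ∂ν, w s < ∞ := ae_lt_top hwm htop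
  have hwp : ∀ s, ∑' n, F s n ^ p.toReal = w s ^ p.toReal := by
    intro s
    simp only [hw, eLpNorm_eq_lintegral_rpow_enorm_toReal hp0 hp', enorm_eq_self, lintegral_count]
    rw [← ENNReal.rpow_mul, one_div_mul_cancel hpp.ne', ENNReal.rpow_one]
  rw [eLpNorm_eq_lintegral_rpow_enorm_toReal hp0 hp', lintegral_count]
  simp only [enorm_eq_self]
  set r := p.toReal
  -- Jensen is applied with weight w to F = w · (F/w): for fixed s the quotients F/w have ℓ^r norm
  -- one, so summing over n leaves only the integral of w.
  have key : ∑' n, (∫⁻ s, F s n ∂ν) ^ r ≤ (∫⁻ s, w s ∂ν) ^ r := by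
    calc ∑' n, (∫⁻ s, F s n ∂ν) ^ r
        ≤ ∑' n, (∫⁻ s, w s ∂ν) ^ (r - 1) * ∫⁻ s, w s * (F s n / w s) ^ r ∂ν := by
          refine ENNReal.tsum_le_tsum fun n => ?_
          refine le_trans ?_ (lintegral_mul_rpow_le hpr hwm.aemeasurable
            ((hF n).div hwm).aemeasurable)
          gcongr ?_ ^ _
          refine lintegral_mono_ae ?_
          filter_upwards [hwfin] with s hs
          rcases eq_or_ne (w s) 0 with h0 | h0
          · have := hFw s n
            rw [h0] at this
            simp [nonpos_iff_eq_zero.1 this]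
          · rw [ENNReal.mul_div_cancel h0 hs.ne]
      _ = (∫⁻ s, w s ∂ν) ^ (r - 1) * ∫⁻ s, ∑' n, w s * (F s n / w s) ^ r ∂ν := by
          rw [ENNReal.tsum_mul_left, lintegral_tsum]
          exact fun n => (hwm.mul (((hF n).div hwm).pow_const _)).aemeasurable
      _ ≤ (∫⁻ s, w s ∂ν) ^ (r - 1) * ∫⁻ s, w s ∂ν := by
          refine mul_le_mul' le_rfl (lintegral_mono_ae ?_)
          filter_upwards [hwfin] with s hs
          rw [ENNReal.tsum_mul_left]
          rcases eq_or_ne (w s) 0 with h0 | h0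
          · simp [h0]
          · have : ∀ n, (F s n / w s) ^ r = F s n ^ r * (w s ^ r)⁻¹ := fun n => by
              rw [ENNReal.div_rpow_of_nonneg _ _ hpp.le, div_eq_mul_inv]
            simp only [this]
            rw [ENNReal.tsum_mul_right, hwp, ENNReal.mul_inv_cancel, mul_one]
            · simp [h0, hpp.le]
            · simp [hs.ne, h0]
      _ = _ := by
          conv_lhs => rw [← ENNReal.rpow_one (∫⁻ s, w s ∂ν), ← ENNReal.rpow_mul, one_mul]
          rw [← ENNReal.rpow_add_of_nonneg _ _ (by linarith) zero_le_one]
          simp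
  calc (∑' n, (∫⁻ s, F s n ∂ν) ^ r) ^ (1 / r) ≤ ((∫⁻ s, w s ∂ν) ^ r) ^ (1 / r) := by gcongr
    _ = _ := by rw [← ENNReal.rpow_mul, mul_one_div_cancel hpp.ne', ENNReal.rpow_one]

/-- The triangle inequality in `ℓ^p` for countable sums. -/
theorem eLpNorm_count_tsum_le {ι κ : Type*} [MeasurableSpace ι] [Countable ι]
    [MeasurableSingletonClass ι] [Countable κ]
    {p : ℝ≥0∞} (hp : 1 ≤ p) (F : κ → ι → ℝ≥0∞) :
    eLpNorm (fun n => ∑' s, F s n) p (Measure.count : Measure ι) ≤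
      ∑' s, eLpNorm (F s) p (Measure.count : Measure ι) := by
  let _ : MeasurableSpace κ := ⊤
  have := eLpNorm_count_lintegral_le (ν := (Measure.count : Measure κ)) hp (F := F)
    (fun n => measurable_from_top)
  simpa only [lintegral_count] using this

end Inequalities

/-! ### Hardy kernels on `(0,∞)` and on `ℤ` -/

/-- The Hardy-type kernel `min(x/y, y/x)^a`. -/
noncomputable def ratioKernel (a x y : ℝ) : ℝ≥0∞ := ENNReal.ofReal (min (x / y) (y / x) ^ a)

theorem ratioKernel_comm (a x y : ℝ) : ratioKernel a x y = ratioKernel a y x := by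
  rw [ratioKernel, ratioKernel, min_comm]

theorem measurable_ratioKernel (a : ℝ) : Measurable (Function.uncurry (ratioKernel a)) := by
  unfold ratioKernel Function.uncurry
  fun_prop

theorem lintegral_dtOverT (g : ℝ → ℝ≥0∞) (hg : Measurable g) :
    ∫⁻ t, g t ∂dtOverT = ∫⁻ t in Ioi (0 : ℝ), ENNReal.ofReal (1 / t) * g t := by
  unfold dtOverT
  rw [lintegral_withDensity_eq_lintegral_mul _ (by fun_prop) hg]
  rfl

theorem ae_dtOverT_pos : ∀ᵐ t ∂dtOverT, 0 < t := by
  have h : ∀ᵐ t ∂(volume.restrict (Ioi (0 : ℝ))), 0 < t := ae_restrict_mem measurableSet_Ioi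
  exact (withDensity_absolutelyContinuous _ _) h

theorem lintegral_Ioc_ratioKernel_le {a x : ℝ} (ha : 0 < a) (hx : 0 < x) :
    ∫⁻ t in Ioc 0 x, ENNReal.ofReal (1 / t) * ratioKernel a x t ≤ ENNReal.ofReal (1 / a) := by
  have hint : IntegrableOn (fun t : ℝ => t ^ (a - 1) * x ^ (-a)) (Ioc 0 x) := by
    have h := (intervalIntegral.intervalIntegrable_rpow' (a := 0) (b := x)
      (by linarith : -1 < a - 1)).mul_const (x ^ (-a))
    exact (intervalIntegrable_iff_integrableOn_Ioc_of_le hx.le).1 h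
  calc ∫⁻ t in Ioc 0 x, ENNReal.ofReal (1 / t) * ratioKernel a x t
      ≤ ∫⁻ t in Ioc 0 x, ENNReal.ofReal (t ^ (a - 1) * x ^ (-a)) := by
        refine setLIntegral_mono' measurableSet_Ioc fun t ht => ?_
        have ht0 : 0 < t := ht.1
        rw [ratioKernel, ← ENNReal.ofReal_mul (by positivity)]
        refine ENNReal.ofReal_le_ofReal ?_
        calc 1 / t * min (x / t) (t / x) ^ a ≤ 1 / t * (t / x) ^ a := by
              gcongr
              exact min_le_right _ _
          _ = _ := by
              rw [Real.div_rpow ht0.le hx.le, Real.rpow_neg hx.le, Real.rpow_sub ht0, Real.rpow_one]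
              field_simp
    _ = ENNReal.ofReal (∫ t in Ioc 0 x, t ^ (a - 1) * x ^ (-a)) := by
        refine (ofReal_integral_eq_lintegral_ofReal hint ?_).symm
        filter_upwards [ae_restrict_mem measurableSet_Ioc] with t ht
        have ht0 : 0 < t := ht.1
        simp only [Pi.zero_apply]
        positivity
    _ = ENNReal.ofReal (1 / a) := by
        rw [← intervalIntegral.integral_of_le hx.le, intervalIntegral.integral_mul_const,
          integral_rpow (Or.inl (by linarith))]
        congr 1
        rw [sub_add_cancel, Real.zero_rpow ha.ne', Real.rpow_neg hx.le]
        have := Real.rpow_pos_of_pos hx a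
        field_simp
        ring

theorem lintegral_Ioi_ratioKernel_le {a x : ℝ} (ha : 0 < a) (hx : 0 < x) :
    ∫⁻ t in Ioi x, ENNReal.ofReal (1 / t) * ratioKernel a x t ≤ ENNReal.ofReal (1 / a) := by
  have hint : IntegrableOn (fun t : ℝ => t ^ (-a - 1) * x ^ a) (Ioi x) :=
    (integrableOn_Ioi_rpow_of_lt (by linarith) hx).mul_const _
  calc ∫⁻ t in Ioi x, ENNReal.ofReal (1 / t) * ratioKernel a x t
      ≤ ∫⁻ t in Ioi x, ENNReal.ofReal (t ^ (-a - 1) * x ^ a) := by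
        refine setLIntegral_mono' measurableSet_Ioi fun t ht => ?_
        have ht0 : 0 < t := hx.trans ht
        rw [ratioKernel, ← ENNReal.ofReal_mul (by positivity)]
        refine ENNReal.ofReal_le_ofReal ?_
        calc 1 / t * min (x / t) (t / x) ^ a ≤ 1 / t * (x / t) ^ a := by
              gcongr
              exact min_le_left _ _
          _ = _ := by
              rw [Real.div_rpow hx.le ht0.le, Real.rpow_sub ht0, Real.rpow_neg ht0.le,
                Real.rpow_one]
              field_simp
    _ = ENNReal.ofReal (∫ t in Ioi x, t ^ (-a - 1) * x ^ a) := by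
        refine (ofReal_integral_eq_lintegral_ofReal hint ?_).symm
        filter_upwards [ae_restrict_mem measurableSet_Ioi] with t ht
        have ht0 : 0 < t := hx.trans ht
        simp only [Pi.zero_apply]
        positivity
    _ = ENNReal.ofReal (1 / a) := by
        rw [integral_mul_const, integral_Ioi_rpow_of_lt (by linarith) hx]
        congr 1
        rw [sub_add_cancel, Real.rpow_neg hx.le]
        have := Real.rpow_pos_of_pos hx a
        field_simp

theorem lintegral_ratioKernel_dtOverT_le {a x : ℝ} (ha : 0 < a) (hx : 0 < x) :
    ∫⁻ t in Ioi (0 : ℝ), ENNReal.ofReal (1 / t) * ratioKernel a x t ≤ ENNReal.ofReal (2 / a) := by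
  rw [← Ioc_union_Ioi_eq_Ioi hx.le]
  refine (lintegral_union_le _ _ _).trans ?_
  refine (add_le_add (lintegral_Ioc_ratioKernel_le ha hx)
    (lintegral_Ioi_ratioKernel_le ha hx)).trans ?_
  rw [← ENNReal.ofReal_add (by positivity) (by positivity)]
  apply ENNReal.ofReal_le_ofReal
  apply le_of_eq
  ring

/-- A size function `ρ` for which the measure behaves like `dρ/ρ` on `(0,∞)`, or is dominated by
it: all kernels `min(x/ρ, ρ/x)^a` are integrable uniformly in `x`. -/
structure LogSize {X : Type*} [MeasurableSpace X] (μ : Measure X) (ρ : X → ℝ) : Prop where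
  measurable : Measurable ρ
  pos : ∀ᵐ x ∂μ, 0 < ρ x
  bound : ∀ a : ℝ, 0 < a → ∃ C : ℝ≥0∞, C ≠ ∞ ∧ ∀ x : ℝ, 0 < x →
    ∫⁻ y, ratioKernel a x (ρ y) ∂μ ≤ C

/-- Schur's test: the kernel is symmetric, so `bound` for σ controls the rows and `bound` for ρ the
columns. Since X and Y may differ, norms over (0,∞) can be transferred to ℤ. -/
theorem LogSize.eLpNorm_le {X Y : Type*} [MeasurableSpace X] [MeasurableSpace Y]
    {μ : Measure X} {ν : Measure Y} [SFinite μ] [SFinite ν] {ρ : X → ℝ} {σ : Y → ℝ}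
    (hρ : LogSize μ ρ) (hσ : LogSize ν σ) {a : ℝ} (ha : 0 < a) :
    ∃ C : ℝ≥0∞, C ≠ ∞ ∧ ∀ q : ℝ≥0∞, 1 ≤ q → ∀ h : Y → ℝ≥0∞, Measurable h →
      eLpNorm (fun x => ∫⁻ y, ratioKernel a (ρ x) (σ y) * h y ∂ν) q μ ≤ C * eLpNorm h q ν := by
  obtain ⟨C, hC, hC'⟩ := hρ.bound a ha
  obtain ⟨D, hD, hD'⟩ := hσ.bound a ha
  refine ⟨max C D, by simp [hC, hD], fun q hq h hh => ?_⟩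
  refine eLpNorm_lintegral_kernel_le hq ?_ ?_ ?_ hh
  · exact (measurable_ratioKernel a).comp
      ((hρ.measurable.comp measurable_fst).prodMk (hσ.measurable.comp measurable_snd))
  · filter_upwards [hρ.pos] with x hx
    exact (hD' _ hx).trans (le_max_right _ _)
  · filter_upwards [hσ.pos] with y hy
    simp_rw [fun x => ratioKernel_comm a (ρ x) (σ y)]
    exact (hC' _ hy).trans (le_max_left _ _)

theorem logSize_sqrt : LogSize dtOverT Real.sqrt where
  measurable := by fun_prop
  pos := by
    filter_upwards [ae_dtOverT_pos] with t ht
    exact Real.sqrt_pos.2 ht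
  bound a ha := by
    refine ⟨ENNReal.ofReal (2 / (a / 2)), ENNReal.ofReal_ne_top, fun x hx => ?_⟩
    rw [lintegral_dtOverT (fun y => ratioKernel a x √y) ((measurable_ratioKernel a).comp
      (measurable_const.prodMk Real.continuous_sqrt.measurable))]
    -- Squaring both sizes halves the exponent: the kernel of order a in √t is the kernel of order
    -- a/2 in t, at x².
    refine le_trans (le_of_eq ?_) (lintegral_ratioKernel_dtOverT_le (x := x ^ 2) (half_pos ha)
      (by positivity))
    refine setLIntegral_congr_fun measurableSet_Ioi fun t ht => ?_
    have ht : 0 < t := ht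
    simp only [ratioKernel]
    congr 2
    have h1 : min (x ^ 2 / t) (t / x ^ 2) = min (x / √t) (√t / x) ^ (2 : ℝ) := by
      have hm : MonotoneOn (fun y : ℝ => y ^ (2 : ℝ)) (Ici 0) :=
        Real.monotoneOn_rpow_Ici_of_exponent_nonneg (by norm_num)
      have := hm.map_min (a := x / √t) (b := √t / x) (mem_Ici.2 (by positivity))
        (mem_Ici.2 (by positivity))
      rw [this]
      norm_num
      rw [div_pow, div_pow, Real.sq_sqrt ht.le]
    rw [h1, ← Real.rpow_mul (by positivity)]
    congr 1
    ring

instance : SFinite dtOverT := by unfold dtOverT; infer_instance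

instance : SFinite weightMeasure := by unfold weightMeasure; infer_instance

theorem lintegral_weightMeasure (g : ℤ → ℝ≥0∞) :
    ∫⁻ n, g n ∂weightMeasure = ∑' n : ℤ, ENNReal.ofReal (1 / (1 + |(n : ℝ)|)) * g n := by
  simp [weightMeasure, lintegral_sum_measure, lintegral_smul_measure]

/-- On [1+m, 2+m) the variable u stays within a factor 2 of 1+m. This costs 2 for the density 1/u
and 2^a for the kernel, and reduces sums over ℕ to integrals against du/u. -/
theorem ratioKernel_nat_le {a x : ℝ} (ha : 0 < a) (hx : 0 < x) (m : ℕ) :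
    ENNReal.ofReal (1 / (1 + m)) * ratioKernel a x (1 + m) ≤
      ENNReal.ofReal (2 * 2 ^ a) *
        ∫⁻ u in Ico (1 + m : ℝ) (2 + m), ENNReal.ofReal (1 / u) * ratioKernel a x u := by
  rw [← lintegral_const_mul' _ _ ENNReal.ofReal_ne_top]
  have hm : (0 : ℝ) < 1 + m := by positivity
  calc ENNReal.ofReal (1 / (1 + m)) * ratioKernel a x (1 + m)
      = ∫⁻ u in Ico (1 + m : ℝ) (2 + m), ENNReal.ofReal (1 / (1 + m)) * ratioKernel a x (1 + m) := by
        rw [setLIntegral_const, Real.volume_Ico, show (2 + m - (1 + m) : ℝ) = 1 by ring]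
        simp
    _ ≤ _ := by
        refine setLIntegral_mono' measurableSet_Ico fun u hu => ?_
        have hu0 : 0 < u := hm.trans_le hu.1
        have hu2 : u ≤ 2 * (1 + m) := by have := hu.2; linarith
        rw [ratioKernel, ratioKernel, ← ENNReal.ofReal_mul (by positivity),
          ← ENNReal.ofReal_mul (by positivity), ← ENNReal.ofReal_mul (by positivity)]
        refine ENNReal.ofReal_le_ofReal ?_
        have h1 : 1 / (1 + (m : ℝ)) ≤ 2 * (1 / u) := by
          rw [mul_one_div, div_le_div_iff₀ hm hu0]; linarith
        have h2 : min (x / (1 + m)) ((1 + m) / x) ≤ 2 * min (x / u) (u / x) := by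
          rw [mul_min_of_nonneg _ _ zero_le_two]
          refine min_le_min ?_ ?_
          · rw [mul_div, div_le_div_iff₀ hm hu0]; nlinarith
          · rw [mul_div]
            gcongr
            linarith [hu.1]
        calc 1 / (1 + (m : ℝ)) * min (x / (1 + m)) ((1 + m) / x) ^ a
            ≤ 2 * (1 / u) * (2 * min (x / u) (u / x)) ^ a := by gcongr
          _ = _ := by
            rw [Real.mul_rpow zero_le_two (by positivity)]
            ring

theorem tsum_nat_ratioKernel_le {a x : ℝ} (ha : 0 < a) (hx : 0 < x) :
    ∑' m : ℕ, ENNReal.ofReal (1 / (1 + m)) * ratioKernel a x (1 + m) ≤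
      ENNReal.ofReal (2 * 2 ^ a) * ENNReal.ofReal (2 / a) := by
  have hdisj : Pairwise (Function.onFun Disjoint fun m : ℕ => Ico (1 + m : ℝ) (2 + m)) := by
    have hmono : Monotone fun m : ℕ => (1 + m : ℝ) := fun i j h => by
      simpa using h
    have := hmono.pairwise_disjoint_on_Ico_succ
    convert this using 4 with m
    simp only [Nat.succ_eq_succ, Nat.succ_eq_add_one, Nat.cast_add, Nat.cast_one]
    ring
  calc _ ≤ ∑' m : ℕ, ENNReal.ofReal (2 * 2 ^ a) *
        ∫⁻ u in Ico (1 + m : ℝ) (2 + m), ENNReal.ofReal (1 / u) * ratioKernel a x u :=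
        ENNReal.tsum_le_tsum fun m => ratioKernel_nat_le ha hx m
    _ = ENNReal.ofReal (2 * 2 ^ a) * ∫⁻ u in ⋃ m : ℕ, Ico (1 + m : ℝ) (2 + m),
          ENNReal.ofReal (1 / u) * ratioKernel a x u := by
        rw [ENNReal.tsum_mul_left, lintegral_iUnion (fun _ => measurableSet_Ico) hdisj]
    _ ≤ _ := by
        refine mul_le_mul' le_rfl (le_trans ?_ (lintegral_ratioKernel_dtOverT_le ha hx))
        refine lintegral_mono_set ?_
        refine iUnion_subset fun m u hu => ?_
        have : (0 : ℝ) ≤ m := m.cast_nonneg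
        have := hu.1
        exact mem_Ioi.2 (by linarith)

theorem logSize_int : LogSize weightMeasure fun n : ℤ => 1 + |(n : ℝ)| where
  measurable := measurable_from_top
  pos := Filter.Eventually.of_forall fun n => by positivity
  bound a ha := by
    refine ⟨ENNReal.ofReal (2 * 2 ^ a) * ENNReal.ofReal (2 / a) +
      ENNReal.ofReal (2 * 2 ^ a) * ENNReal.ofReal (2 / a), by finiteness, fun x hx => ?_⟩
    -- The negative integers -(m+1) reproduce the sum over ℕ without its first term, so each half is
    -- bounded by the same constant.
    rw [lintegral_weightMeasure, tsum_of_nat_of_neg_add_one ENNReal.summable ENNReal.summable]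
    refine add_le_add ?_ ?_
    · refine le_trans (le_of_eq ?_) (tsum_nat_ratioKernel_le ha hx)
      simp
    · refine le_trans ?_ (tsum_nat_ratioKernel_le ha hx)
      refine le_trans (le_of_eq ?_) (ENNReal.tsum_comp_le_tsum_of_injective
        (f := fun m : ℕ => m + 1) (fun i j h => by simpa using h)
        (fun m : ℕ => ENNReal.ofReal (1 / (1 + m)) * ratioKernel a x (1 + m)))
      refine tsum_congr fun m => ?_
      have : |((-((m : ℤ) + 1) : ℤ) : ℝ)| = ((m + 1 : ℕ) : ℝ) := by
        push_cast
        rw [abs_neg, abs_of_nonneg (by positivity)]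
      rw [this]

/-! ### The heat semigroup as an exponential series on functions of exponential growth -/

/-- Functions on `ℤ` of at most exponential growth of order one. -/
def ExpGrowth (f : ℤ → ℝ) : Prop := ∃ C : ℝ, ∀ j : ℤ, |f j| ≤ C * Real.exp |(j : ℝ)|

/-- Translation of a function on `ℤ`, as a linear map. -/
def translate (k : ℤ) : Module.End ℝ (ℤ → ℝ) := LinearMap.funLeft ℝ ℝ fun n => n + k

@[simp] theorem translate_apply (k : ℤ) (f : ℤ → ℝ) (n : ℤ) : translate k f n = f (n + k) := rfl

/-- The adjacency operator of the graph `ℤ`. -/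
def adjSum : Module.End ℝ (ℤ → ℝ) := translate (-1) + translate 1

theorem adjSum_apply (f : ℤ → ℝ) (n : ℤ) : adjSum f n = f (n - 1) + f (n + 1) := rfl

/-- The discrete Laplacian. -/
def laplacian (f : ℤ → ℝ) : ℤ → ℝ := fun n => f (n + 1) - 2 * f n + f (n - 1)

theorem translate_pow (k : ℤ) (a : ℕ) (f : ℤ → ℝ) (n : ℤ) :
    (translate k ^ a) f n = f (n + a * k) := by
  induction a generalizing n with
  | zero => simp
  | succ a ih =>
    rw [pow_succ', Module.End.mul_apply, translate_apply, ih]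
    congr 1
    push_cast
    ring

theorem translate_commute (k l : ℤ) : Commute (translate k) (translate l) := by
  ext1 f
  funext n
  simp only [Module.End.mul_apply, translate_apply]
  congr 1
  ring

theorem choose_eq_div {i j N : ℕ} (h : i + j = N) :
    (N.choose i : ℝ) = N.factorial / (i.factorial * j.factorial) := by
  subst h
  rw [Nat.choose_symm_add, Nat.add_choose, Nat.cast_div (Nat.factorial_mul_factorial_dvd_factorial_add _ _)
    (by positivity)]
  push_cast
  rfl

/-- The two unit translations commute, so this is the binomial theorem in the algebra of
endomorphisms. -/
theorem adjSum_pow_apply (N : ℕ) (f : ℤ → ℝ) (n : ℤ) :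
    (adjSum ^ N) f n =
      ∑ z ∈ Finset.HasAntidiagonal.antidiagonal N, (N.choose z.1 : ℝ) * f (n - z.1 + z.2) := by
  rw [adjSum, (translate_commute (-1) 1).add_pow', LinearMap.sum_apply, Finset.sum_apply]
  refine Finset.sum_congr rfl fun z _ => ?_
  simp only [← Nat.cast_smul_eq_nsmul ℝ, LinearMap.smul_apply, Pi.smul_apply, Module.End.mul_apply,
    translate_pow, smul_eq_mul]
  congr 2
  ring

namespace ExpGrowth

variable {f g : ℤ → ℝ}

theorem exists_pos (hf : ExpGrowth f) : ∃ C : ℝ, 0 ≤ C ∧ ∀ j : ℤ, |f j| ≤ C * Real.exp |(j : ℝ)| := by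
  obtain ⟨C, hC⟩ := hf
  refine ⟨C, ?_, hC⟩
  have := (abs_nonneg _).trans (hC 0)
  simpa using this

theorem translate_bound {C : ℝ} (hC : 0 ≤ C) (hf : ∀ j : ℤ, |f j| ≤ C * Real.exp |(j : ℝ)|)
    (n k : ℤ) : |f (n + k)| ≤ C * Real.exp |(k : ℝ)| * Real.exp |(n : ℝ)| := by
  refine (hf _).trans ?_
  rw [mul_assoc, ← Real.exp_add]
  gcongr
  push_cast
  rw [add_comm]
  exact abs_add_le _ _

theorem translate (hf : ExpGrowth f) (k : ℤ) : ExpGrowth (translate k f) := by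
  obtain ⟨C, hC, hf⟩ := hf.exists_pos
  exact ⟨_, fun n => translate_bound hC hf n k⟩

theorem add (hf : ExpGrowth f) (hg : ExpGrowth g) : ExpGrowth (f + g) := by
  obtain ⟨C, hf⟩ := hf
  obtain ⟨D, hg⟩ := hg
  refine ⟨C + D, fun n => ?_⟩
  rw [add_mul]
  exact (abs_add_le _ _).trans (add_le_add (hf n) (hg n))

theorem smul (hf : ExpGrowth f) (c : ℝ) : ExpGrowth (c • f) := by
  obtain ⟨C, hf⟩ := hf
  refine ⟨|c| * C, fun n => ?_⟩
  rw [Pi.smul_apply, smul_eq_mul, abs_mul, mul_assoc]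
  exact mul_le_mul_of_nonneg_left (hf n) (abs_nonneg c)

theorem deltaRight (hf : ExpGrowth f) : ExpGrowth (deltaRight f) := by
  have : DiscreteBesov.deltaRight f = f + (-1 : ℝ) • DiscreteBesov.translate 1 f := by
    funext n
    simp [DiscreteBesov.deltaRight, sub_eq_add_neg]
  rw [this]
  exact hf.add ((hf.translate 1).smul _)

theorem iterate_deltaRight (hf : ExpGrowth f) (l : ℕ) : ExpGrowth (DiscreteBesov.deltaRight^[l] f) := by
  induction l with
  | zero => exact hf
  | succ l ih =>
    rw [Function.iterate_succ_apply']
    exact ih.deltaRight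

theorem adjSum (hf : ExpGrowth f) : ExpGrowth (adjSum f) :=
  (hf.translate (-1)).add (hf.translate 1)

theorem laplacian_eq (f : ℤ → ℝ) :
    DiscreteBesov.laplacian f = DiscreteBesov.adjSum f + (-2 : ℝ) • f := by
  funext n
  simp only [DiscreteBesov.laplacian, Pi.add_apply, Pi.smul_apply, adjSum_apply, smul_eq_mul]
  ring

theorem laplacian (hf : ExpGrowth f) : ExpGrowth (laplacian f) := by
  rw [laplacian_eq]
  exact hf.adjSum.add (hf.smul _)

theorem adjSum_pow_bound {C : ℝ} (hC : 0 ≤ C) (hf : ∀ j : ℤ, |f j| ≤ C * Real.exp |(j : ℝ)|)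
    (N : ℕ) (n : ℤ) :
    |(DiscreteBesov.adjSum ^ N) f n| ≤ C * Real.exp |(n : ℝ)| * (2 * Real.exp 1) ^ N := by
  induction N generalizing f C with
  | zero => simpa using hf n
  | succ N ih =>
    rw [pow_succ, Module.End.mul_apply]
    refine (ih (f := DiscreteBesov.adjSum f) (C := 2 * Real.exp 1 * C) (by positivity)
      fun j => ?_).trans (le_of_eq (by ring))
    rw [adjSum_apply]
    have h1 := translate_bound hC hf j (-1)
    have h2 := translate_bound hC hf j 1
    simp only [Int.cast_neg, Int.cast_one, abs_neg, abs_one, ← sub_eq_add_neg] at h1 h2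
    calc _ ≤ _ := abs_add_le _ _
      _ ≤ _ := add_le_add h1 h2
      _ = _ := by ring

/-- Bound for the terms of the series over pairs of Poisson weights. -/
theorem pair_bound {C : ℝ} (hC : 0 ≤ C) (hf : ∀ j : ℤ, |f j| ≤ C * Real.exp |(j : ℝ)|)
    (t : ℝ) (n : ℤ) (z : ℕ × ℕ) :
    |t ^ (z.1 + z.2) / (z.1.factorial * z.2.factorial) * f (n - z.1 + z.2)| ≤
      C * Real.exp |(n : ℝ)| * ((|t| * Real.exp 1) ^ z.1 / z.1.factorial *
        ((|t| * Real.exp 1) ^ z.2 / z.2.factorial)) := by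
  have h := translate_bound hC hf n (-(z.1 : ℤ) + z.2)
  rw [← add_assoc, ← sub_eq_add_neg] at h
  have h3 : Real.exp |((-(z.1 : ℤ) + z.2 : ℤ) : ℝ)| ≤ Real.exp 1 ^ z.1 * Real.exp 1 ^ z.2 := by
    rw [← Real.exp_nat_mul, ← Real.exp_nat_mul, ← Real.exp_add]
    refine Real.exp_le_exp.2 ?_
    push_cast
    refine (abs_add_le _ _).trans ?_
    simp
  rw [abs_mul, abs_div, abs_pow, abs_of_pos (by positivity : (0 : ℝ) <
    z.1.factorial * z.2.factorial)]
  calc _ ≤ |t| ^ (z.1 + z.2) / (z.1.factorial * z.2.factorial) *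
        (C * (Real.exp 1 ^ z.1 * Real.exp 1 ^ z.2) * Real.exp |(n : ℝ)|) := by
        gcongr
        refine h.trans ?_
        gcongr
    _ = _ := by
        rw [pow_add, mul_pow, mul_pow]
        field_simp

theorem summable_pair_weights (x : ℝ) : Summable fun z : ℕ × ℕ =>
    x ^ z.1 / z.1.factorial * (x ^ z.2 / z.2.factorial) :=
  summable_mul_of_summable_norm (Real.summable_pow_div_factorial x).norm
    (Real.summable_pow_div_factorial x).norm

theorem summable_pair (hf : ExpGrowth f) (t : ℝ) (n : ℤ) : Summable fun z : ℕ × ℕ =>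
    t ^ (z.1 + z.2) / (z.1.factorial * z.2.factorial) * f (n - z.1 + z.2) := by
  obtain ⟨C, hC, hf⟩ := hf.exists_pos
  refine Summable.of_norm_bounded ((summable_pair_weights (|t| * Real.exp 1)).mul_left
    (C * Real.exp |(n : ℝ)|)) fun z => ?_
  exact pair_bound hC hf t n z

end ExpGrowth

/-- Pairs `(a, b)` are determined by `a - b` and `min a b`. -/
def pairEquiv : ℤ × ℕ ≃ ℕ × ℕ where
  toFun z := (z.2 + z.1.toNat, z.2 + (-z.1).toNat)
  invFun z := ((z.1 : ℤ) - z.2, min z.1 z.2)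
  left_inv z := by
    rcases z with ⟨d, m⟩
    ext <;> simp only <;> omega
  right_inv z := by
    rcases z with ⟨a, b⟩
    ext <;> simp only <;> omega

/-- The Bessel coefficient 1/(m! (m+|d|)!) is the product 1/(a! b!) for the pair with a - b = d and
min(a, b) = m. Summing over pairs is thus summing over d and then over the Bessel index m. -/
theorem pair_term_eq (f : ℤ → ℝ) (t : ℝ) (n d : ℤ) (m : ℕ) :
    t ^ ((pairEquiv (d, m)).1 + (pairEquiv (d, m)).2) /
      ((pairEquiv (d, m)).1.factorial * (pairEquiv (d, m)).2.factorial) *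
        f (n - (pairEquiv (d, m)).1 + (pairEquiv (d, m)).2) =
    (2 * t / 2) ^ (2 * m + d.natAbs) /
      ((m.factorial : ℝ) * Real.Gamma ((m : ℝ) + (d.natAbs : ℝ) + 1)) * f (n - d) := by
  have hG : Real.Gamma ((m : ℝ) + (d.natAbs : ℝ) + 1) = ((m + d.natAbs).factorial : ℝ) := by
    rw [← Real.Gamma_nat_eq_factorial]
    push_cast
    rfl
  rw [hG, mul_div_cancel_left₀ t two_ne_zero]
  simp only [pairEquiv, Equiv.coe_fn_mk]
  rcases le_total 0 d with hd | hd
  · have h1 : d.toNat = d.natAbs := by omega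
    have h2 : (-d).toNat = 0 := by omega
    rw [h1, h2]
    have h3 : n - ((m + d.natAbs : ℕ) : ℤ) + ((m + 0 : ℕ) : ℤ) = n - d := by omega
    rw [h3, add_zero, mul_comm (m.factorial : ℝ)]
    congr 3
    ring
  · have h1 : d.toNat = 0 := by omega
    have h2 : (-d).toNat = d.natAbs := by omega
    rw [h1, h2]
    have h3 : n - ((m + 0 : ℕ) : ℤ) + ((m + d.natAbs : ℕ) : ℤ) = n - d := by omega
    rw [h3, add_zero]
    congr 3
    ring

namespace ExpGrowth

variable {f g : ℤ → ℝ}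

theorem hasSum_heatKernel_aux (hf : ExpGrowth f) (t : ℝ) (n : ℤ) :
    HasSum (fun d : ℤ => besselI d (2 * t) * f (n - d)) (∑' z : ℕ × ℕ,
      t ^ (z.1 + z.2) / (z.1.factorial * z.2.factorial) * f (n - z.1 + z.2)) := by
  have h := (pairEquiv.hasSum_iff (f := fun z : ℕ × ℕ =>
    t ^ (z.1 + z.2) / (z.1.factorial * z.2.factorial) * f (n - z.1 + z.2))).2
    (hf.summable_pair t n).hasSum
  -- Taking f = 1 gives summability of the Bessel series itself, including those d at which f (n -
  -- d) vanishes.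
  have hone : ExpGrowth fun _ => (1 : ℝ) := ⟨1, fun j => by simp⟩
  have h1 := pairEquiv.summable_iff.2 (hone.summable_pair t 0)
  refine h.prod_fiberwise fun d => ?_
  simp only [Function.comp_apply, pair_term_eq]
  refine HasSum.mul_right _ ?_
  have h2 := h1.prod_factor d
  simp only [Function.comp_apply] at h2
  have h3 : ∀ m : ℕ, _ := fun m => pair_term_eq (fun _ => (1 : ℝ)) t 0 d m
  simp only [h3, mul_one] at h2
  exact h2.hasSum

theorem hasSum_heatKernel (hf : ExpGrowth f) (t : ℝ) (n : ℤ) :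
    HasSum (fun j : ℤ => heatKernel t (n - j) * f j) (heatSemigroup t f n) := by
  have h := (Equiv.subLeft n).hasSum_iff.2 (hf.hasSum_heatKernel_aux t n)
  have h2 := h.mul_left (Real.exp (-2 * t))
  have h3 : Summable (fun j : ℤ => heatKernel t (n - j) * f j) := by
    refine h2.summable.congr fun j => ?_
    simp [heatKernel, mul_assoc]
  exact h3.hasSum

theorem heatSemigroup_eq_tsum_pair (hf : ExpGrowth f) (t : ℝ) (n : ℤ) :
    heatSemigroup t f n = Real.exp (-2 * t) * ∑' z : ℕ × ℕ,
      t ^ (z.1 + z.2) / (z.1.factorial * z.2.factorial) * f (n - z.1 + z.2) := by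
  have h := (Equiv.subLeft n).hasSum_iff.2 (hf.hasSum_heatKernel_aux t n)
  rw [← (h.mul_left (Real.exp (-2 * t))).tsum_eq, heatSemigroup]
  refine tsum_congr fun j => ?_
  simp [heatKernel, mul_assoc]

theorem heatSemigroup (hf : ExpGrowth f) (t : ℝ) : ExpGrowth (heatSemigroup t f) := by
  obtain ⟨C, hC, hf'⟩ := hf.exists_pos
  refine ⟨Real.exp (-2 * t) * (C * ∑' z : ℕ × ℕ, ((|t| * Real.exp 1) ^ z.1 / z.1.factorial *
        ((|t| * Real.exp 1) ^ z.2 / z.2.factorial))), fun n => ?_⟩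
  rw [hf.heatSemigroup_eq_tsum_pair, abs_mul, abs_of_pos (Real.exp_pos _), mul_assoc]
  gcongr
  rw [mul_right_comm, ← tsum_mul_left]
  exact tsum_of_norm_bounded (f := fun z : ℕ × ℕ =>
    t ^ (z.1 + z.2) / (z.1.factorial * z.2.factorial) * f (n - z.1 + z.2))
    ((summable_pair_weights (|t| * Real.exp 1)).mul_left
    (C * Real.exp |(n : ℝ)|)).hasSum (fun z => pair_bound hC hf' t n z)

/-- Grouping the pairs along antidiagonals a + b = N produces the binomial expansion of `adjSum ^
N`. Hence e^{tΔ_d} = e^{-2t} exp(t · `adjSum`), from which the semigroup law and the heat equation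
are read off. -/
theorem heatSemigroup_eq_tsum (hf : ExpGrowth f) (t : ℝ) (n : ℤ) :
    DiscreteBesov.heatSemigroup t f n = Real.exp (-2 * t) *
      ∑' N : ℕ, t ^ N / N.factorial * (DiscreteBesov.adjSum ^ N) f n := by
  rw [hf.heatSemigroup_eq_tsum_pair]
  congr 1
  have h := (Finset.HasAntidiagonal.sigmaAntidiagonalEquivProd (A := ℕ)).hasSum_iff.2 (hf.summable_pair t n).hasSum
  refine (h.sigma fun N => hasSum_fintype _).tsum_eq.symm.trans (tsum_congr fun N => ?_)
  rw [adjSum_pow_apply, Finset.mul_sum, ← Finset.sum_coe_sort (Finset.HasAntidiagonal.antidiagonal N)]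
  refine Finset.sum_congr rfl fun z _ => ?_
  have hz : z.1.1 + z.1.2 = N := Finset.HasAntidiagonal.mem_antidiagonal.1 z.2
  simp only [Function.comp_apply, Finset.HasAntidiagonal.sigmaAntidiagonalEquivProd_apply]
  have hc := choose_eq_div hz
  rw [hz, hc]
  field_simp

end ExpGrowth

/-! ### Exponential series: differentiation and addition formula -/

section ExponentialSeries

variable {a : ℕ → ℝ} {C r : ℝ}

theorem summable_exp_series (ha : ∀ N, |a N| ≤ C * r ^ N) (t : ℝ) :
    Summable fun N : ℕ => t ^ N / N.factorial * a N := by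
  refine Summable.of_norm_bounded ((Real.summable_pow_div_factorial (|t| * r)).mul_left C)
    fun N => ?_
  rw [Real.norm_eq_abs, abs_mul, abs_div, abs_pow, Nat.abs_cast]
  calc _ ≤ |t| ^ N / N.factorial * (C * r ^ N) := by gcongr; exact ha N
    _ = _ := by rw [mul_pow]; ring

theorem hasDerivAt_exp_series (ha : ∀ N, |a N| ≤ C * r ^ N) (t : ℝ) :
    HasDerivAt (fun t => ∑' N : ℕ, t ^ N / N.factorial * a N)
      (∑' N : ℕ, t ^ N / N.factorial * a (N + 1)) t := by
  set R := |t| + 1 with hR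
  have hR0 : 0 ≤ R := by positivity
  -- Majorant of the differentiated terms on the ball of radius |t| + 1. At N = 0 the factor N
  -- vanishes, so the truncated exponent N - 1 is harmless.
  set u : ℕ → ℝ := fun N => N * R ^ (N - 1) / N.factorial * |a N| with hu
  have hus : Summable u := by
    refine (summable_nat_add_iff 1).1 ?_
    refine Summable.of_nonneg_of_le (fun N => by positivity) (fun N => ?_)
      (((Real.summable_pow_div_factorial (R * r)).mul_left (C * r)))
    simp only [hu, Nat.add_sub_cancel]
    have hfac : ((N + 1).factorial : ℝ) = (N + 1) * N.factorial := by
      rw [Nat.factorial_succ]; push_cast; ring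
    calc _ ≤ ((N + 1 : ℕ) : ℝ) * R ^ N / (N + 1).factorial * (C * r ^ (N + 1)) := by
          gcongr
          exact ha _
      _ = _ := by
          rw [hfac, mul_pow, pow_succ r]
          push_cast
          field_simp
  have hmem : t ∈ Metric.ball (0 : ℝ) R := by simp [hR]
  have h := hasDerivAt_tsum_of_isPreconnected (g := fun (N : ℕ) (t : ℝ) => t ^ N / N.factorial * a N)
    (g' := fun (N : ℕ) (t : ℝ) => N * t ^ (N - 1) / N.factorial * a N) hus
    (Metric.isOpen_ball (x := (0 : ℝ)) (ε := R)) (convex_ball _ _).isPreconnected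
    (fun N y _ => ((hasDerivAt_pow N y).div_const _).mul_const _)
    (fun N y hy => by
      have hy' : |y| ≤ R := by simpa using (Metric.mem_ball.1 hy).le
      simp only [hu, Real.norm_eq_abs, abs_mul, abs_div, abs_pow, Nat.abs_cast]
      gcongr)
    hmem (summable_exp_series ha t) hmem
  refine h.congr_deriv ?_
  have hs : Summable fun N : ℕ => N * t ^ (N - 1) / N.factorial * a N := by
    refine Summable.of_norm_bounded hus fun N => ?_
    simp only [hu, Real.norm_eq_abs, abs_mul, abs_div, abs_pow, Nat.abs_cast]
    gcongr
    linarith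
  rw [hs.tsum_eq_zero_add]
  simp only [Nat.cast_zero, zero_mul, zero_div, zero_add, Nat.add_sub_cancel]
  refine tsum_congr fun N => ?_
  have hfac : ((N + 1).factorial : ℝ) = (N + 1) * N.factorial := by
    rw [Nat.factorial_succ]; push_cast; ring
  rw [hfac]
  push_cast
  field_simp

/-- The proof of e^{s+t} = e^s e^t: absolute convergence over pairs, then the binomial theorem on
each antidiagonal. -/
theorem exp_series_add (ha : ∀ N, |a N| ≤ C * r ^ N) (s t : ℝ) :
    ∑' N : ℕ, (s + t) ^ N / N.factorial * a N =
      ∑' i : ℕ, s ^ i / i.factorial * ∑' j : ℕ, t ^ j / j.factorial * a (i + j) := by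
  have hs : Summable fun z : ℕ × ℕ =>
      s ^ z.1 / z.1.factorial * (t ^ z.2 / z.2.factorial * a (z.1 + z.2)) := by
    refine Summable.of_norm_bounded ((summable_mul_of_summable_norm
      (Real.summable_pow_div_factorial (|s| * r)).norm
      (Real.summable_pow_div_factorial (|t| * r)).norm).mul_left C) fun z => ?_
    simp only [Real.norm_eq_abs, abs_mul, abs_div, abs_pow, Nat.abs_cast]
    calc _ ≤ |s| ^ z.1 / z.1.factorial * (|t| ^ z.2 / z.2.factorial * (C * r ^ (z.1 + z.2))) := by
          gcongr
          exact ha _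
      _ = _ := by rw [pow_add, mul_pow, mul_pow]; ring
  have h1 := (Finset.HasAntidiagonal.sigmaAntidiagonalEquivProd (A := ℕ)).hasSum_iff.2 hs.hasSum
  have h2 := (h1.sigma fun N => hasSum_fintype _).tsum_eq
  simp only [← tsum_mul_left]
  rw [← hs.tsum_prod, ← h2]
  refine tsum_congr fun N => ?_
  rw [add_pow, Finset.sum_div, Finset.sum_mul,
    ← Finset.Nat.sum_antidiagonal_eq_sum_range_succ (fun i j => s ^ i * t ^ j * (N.choose i : ℝ) /
      N.factorial * a N), ← Finset.sum_coe_sort (Finset.HasAntidiagonal.antidiagonal N)]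
  refine Finset.sum_congr rfl fun z _ => ?_
  have hz : z.1.1 + z.1.2 = N := Finset.HasAntidiagonal.mem_antidiagonal.1 z.2
  simp only [Function.comp_apply, Finset.HasAntidiagonal.sigmaAntidiagonalEquivProd_apply]
  have hc := choose_eq_div hz
  rw [hz, hc]
  field_simp

end ExponentialSeries

/-! ### Commutation rules, semigroup law and heat equation -/

theorem heatSemigroup_translate (t : ℝ) (f : ℤ → ℝ) (k n : ℤ) :
    heatSemigroup t (translate k f) n = heatSemigroup t f (n + k) := by
  rw [heatSemigroup, heatSemigroup, ← (Equiv.addRight k).tsum_eq (fun j => heatKernel t (n + k - j) * f j)]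
  refine tsum_congr fun j => ?_
  simp

namespace ExpGrowth

variable {f g : ℤ → ℝ}

theorem exists_adjSum_bound (hf : ExpGrowth f) (n : ℤ) :
    ∃ C r : ℝ, ∀ N, |(DiscreteBesov.adjSum ^ N) f n| ≤ C * r ^ N := by
  obtain ⟨C, hC, hf⟩ := hf.exists_pos
  exact ⟨_, _, fun N => adjSum_pow_bound hC hf N n⟩

theorem heatSemigroup_add (hf : ExpGrowth f) (hg : ExpGrowth g) (t : ℝ) :
    DiscreteBesov.heatSemigroup t (f + g) =
      DiscreteBesov.heatSemigroup t f + DiscreteBesov.heatSemigroup t g := by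
  funext n
  rw [Pi.add_apply, ← ((hf.hasSum_heatKernel t n).add (hg.hasSum_heatKernel t n)).tsum_eq]
  refine tsum_congr fun j => ?_
  rw [Pi.add_apply, mul_add]

theorem heatSemigroup_smul (c t : ℝ) :
    DiscreteBesov.heatSemigroup t (c • f) = c • DiscreteBesov.heatSemigroup t f := by
  funext n
  simp only [DiscreteBesov.heatSemigroup, Pi.smul_apply, smul_eq_mul, ← tsum_mul_left]
  refine tsum_congr fun j => ?_
  ring

theorem heatSemigroup_deltaRight (hf : ExpGrowth f) (t : ℝ) :
    DiscreteBesov.heatSemigroup t (DiscreteBesov.deltaRight f) =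
      DiscreteBesov.deltaRight (DiscreteBesov.heatSemigroup t f) := by
  have : DiscreteBesov.deltaRight f = f + (-1 : ℝ) • DiscreteBesov.translate 1 f := by
    funext n
    simp [DiscreteBesov.deltaRight, sub_eq_add_neg]
  rw [this, hf.heatSemigroup_add ((hf.translate 1).smul _), heatSemigroup_smul]
  funext n
  simp [DiscreteBesov.deltaRight, sub_eq_add_neg, heatSemigroup_translate]

theorem heatSemigroup_adjSum (hf : ExpGrowth f) (t : ℝ) :
    DiscreteBesov.heatSemigroup t (DiscreteBesov.adjSum f) =
      DiscreteBesov.adjSum (DiscreteBesov.heatSemigroup t f) := by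
  have : DiscreteBesov.adjSum f = DiscreteBesov.translate (-1) f + DiscreteBesov.translate 1 f := rfl
  rw [this, (hf.translate (-1)).heatSemigroup_add (hf.translate 1)]
  funext n
  rw [Pi.add_apply, heatSemigroup_translate, heatSemigroup_translate]
  rfl

theorem adjSum_pow (hf : ExpGrowth f) (N : ℕ) : ExpGrowth ((DiscreteBesov.adjSum ^ N) f) := by
  induction N generalizing f with
  | zero => exact hf
  | succ N ih => rw [pow_succ, Module.End.mul_apply]; exact ih hf.adjSum

theorem heatSemigroup_adjSum_pow (hf : ExpGrowth f) (t : ℝ) (N : ℕ) :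
    DiscreteBesov.heatSemigroup t ((DiscreteBesov.adjSum ^ N) f) =
      (DiscreteBesov.adjSum ^ N) (DiscreteBesov.heatSemigroup t f) := by
  induction N with
  | zero => rfl
  | succ N ih =>
    rw [pow_succ', Module.End.mul_apply, Module.End.mul_apply, (hf.adjSum_pow N).heatSemigroup_adjSum,
      ih]

theorem heatSemigroup_semigroup (hf : ExpGrowth f) (s t : ℝ) :
    DiscreteBesov.heatSemigroup s (DiscreteBesov.heatSemigroup t f) =
      DiscreteBesov.heatSemigroup (s + t) f := by
  funext n
  obtain ⟨C, r, hr⟩ := hf.exists_adjSum_bound n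
  rw [(hf.heatSemigroup t).heatSemigroup_eq_tsum, hf.heatSemigroup_eq_tsum, exp_series_add hr,
    show -2 * (s + t) = -2 * s + -2 * t by ring, Real.exp_add, mul_assoc]
  congr 1
  rw [← tsum_mul_left]
  refine tsum_congr fun i => ?_
  rw [← hf.heatSemigroup_adjSum_pow, (hf.adjSum_pow i).heatSemigroup_eq_tsum, mul_left_comm]
  congr 2
  refine tsum_congr fun j => ?_
  rw [add_comm i j, pow_add, Module.End.mul_apply]

theorem heatSemigroup_zero (hf : ExpGrowth f) : DiscreteBesov.heatSemigroup 0 f = f := by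
  funext n
  rw [hf.heatSemigroup_eq_tsum, tsum_eq_single 0 fun N hN => by simp [hN]]
  simp

theorem heatSemigroup_laplacian (hf : ExpGrowth f) (t : ℝ) (n : ℤ) :
    DiscreteBesov.heatSemigroup t (DiscreteBesov.laplacian f) n =
      DiscreteBesov.heatSemigroup t (DiscreteBesov.adjSum f) n -
        2 * DiscreteBesov.heatSemigroup t f n := by
  rw [laplacian_eq, hf.adjSum.heatSemigroup_add (hf.smul _), heatSemigroup_smul]
  simp only [Pi.add_apply, Pi.smul_apply, smul_eq_mul]
  ring

/-- The heat equation. -/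
theorem hasDerivAt_heatSemigroup (hf : ExpGrowth f) (t : ℝ) (n : ℤ) :
    HasDerivAt (fun s => DiscreteBesov.heatSemigroup s f n)
      (DiscreteBesov.heatSemigroup t (DiscreteBesov.laplacian f) n) t := by
  obtain ⟨C, r, hr⟩ := hf.exists_adjSum_bound n
  have h1 := hasDerivAt_exp_series hr t
  have h2 : HasDerivAt (fun s : ℝ => Real.exp (-2 * s)) (Real.exp (-2 * t) * (-2)) t := by
    simpa using ((hasDerivAt_id t).const_mul (-2)).exp
  have h3 := h2.mul h1
  have h4 : (fun s => DiscreteBesov.heatSemigroup s f n) = fun s => Real.exp (-2 * s) *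
      ∑' N : ℕ, s ^ N / N.factorial * (DiscreteBesov.adjSum ^ N) f n :=
    funext fun s => hf.heatSemigroup_eq_tsum s n
  rw [h4]
  refine h3.congr_deriv ?_
  rw [hf.heatSemigroup_laplacian, hf.adjSum.heatSemigroup_eq_tsum, hf.heatSemigroup_eq_tsum]
  simp only [pow_succ, Module.End.mul_apply]
  ring

theorem iterate_laplacian (hf : ExpGrowth f) (k : ℕ) : ExpGrowth (DiscreteBesov.laplacian^[k] f) := by
  induction k with
  | zero => exact hf
  | succ k ih =>
    rw [Function.iterate_succ_apply']
    exact ih.laplacian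

theorem iteratedDeriv_heatSemigroup (hf : ExpGrowth f) (k : ℕ) (t : ℝ) (n : ℤ) :
    iteratedDeriv k (fun s => DiscreteBesov.heatSemigroup s f n) t =
      DiscreteBesov.heatSemigroup t (DiscreteBesov.laplacian^[k] f) n := by
  induction k generalizing t with
  | zero => simp
  | succ k ih =>
    rw [iteratedDeriv_succ, funext ih, Function.iterate_succ_apply']
    exact ((hf.iterate_laplacian k).hasDerivAt_heatSemigroup t n).deriv

theorem continuous_heatSemigroup (hf : ExpGrowth f) (n : ℤ) :
    Continuous fun s => DiscreteBesov.heatSemigroup s f n :=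
  continuous_iff_continuousAt.2 fun t => (hf.hasDerivAt_heatSemigroup t n).continuousAt

end ExpGrowth

theorem laplacian_eq_deltaRight (f : ℤ → ℝ) :
    laplacian f = translate (-1) (deltaRight^[2] f) := by
  funext n
  simp only [laplacian, Function.iterate_succ, Function.iterate_zero, Function.comp_apply, id,
    translate_apply, deltaRight]
  rw [show n + -1 + 1 + 1 = n + 1 by ring, show n + -1 + 1 = n by ring, ← sub_eq_add_neg]
  ring

theorem deltaRight_translate (k : ℤ) (f : ℤ → ℝ) :
    deltaRight (translate k f) = translate k (deltaRight f) := by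
  funext n
  simp only [deltaRight, translate_apply]
  rw [add_right_comm]

theorem iterate_deltaRight_translate (l : ℕ) (k : ℤ) (f : ℤ → ℝ) :
    deltaRight^[l] (translate k f) = translate k (deltaRight^[l] f) := by
  induction l with
  | zero => rfl
  | succ l ih => rw [Function.iterate_succ_apply', ih, deltaRight_translate,
      Function.iterate_succ_apply']

theorem translate_translate (k l : ℤ) (f : ℤ → ℝ) :
    translate k (translate l f) = translate (k + l) f := by
  funext n
  simp only [translate_apply]
  rw [add_assoc]

/-- Time derivatives become even-order differences. The translation does not affect ℓ^p norms, but
it moves the evaluation point in pointwise estimates. -/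
theorem iterate_laplacian_eq (k : ℕ) (f : ℤ → ℝ) :
    laplacian^[k] f = translate (-k) (deltaRight^[2 * k] f) := by
  induction k with
  | zero => funext n; simp
  | succ k ih =>
    rw [Function.iterate_succ_apply', ih, laplacian_eq_deltaRight, iterate_deltaRight_translate,
      translate_translate, ← Function.iterate_add_apply]
    congr 2
    · push_cast; ring
    · ring_nf

/-! ### Poisson moments and the gradient estimate -/

section Moments

variable {y S : ℝ}

/-- The Poisson identity E[m c(m)] = y E[c(m+1)], unnormalised. Applied twice it gives the second
moment. -/
theorem hasSum_pow_div_factorial_mul_nat {c : ℕ → ℝ}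
    (h : HasSum (fun m : ℕ => y ^ m / m.factorial * c (m + 1)) S) :
    HasSum (fun m : ℕ => y ^ m / m.factorial * (m * c m)) (y * S) := by
  have h1 : HasSum (fun m : ℕ => y ^ (m + 1) / (m + 1).factorial * (((m + 1 : ℕ) : ℝ) * c (m + 1)))
      (y * S) := by
    refine (h.mul_left y).congr_fun fun m => ?_
    rw [Nat.factorial_succ]
    push_cast
    field_simp
    ring
  simpa using (hasSum_nat_add_iff (f := fun m : ℕ => y ^ m / m.factorial * (m * c m)) 1).1 h1

theorem hasSum_pow_div_factorial (y : ℝ) :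
    HasSum (fun m : ℕ => y ^ m / m.factorial) (Real.exp y) := by
  rw [Real.exp_eq_exp_ℝ]
  exact NormedSpace.expSeries_div_hasSum_exp y

theorem hasSum_poisson_sq (y s : ℝ) :
    HasSum (fun m : ℕ => y ^ m / m.factorial * ((m : ℝ) - s) ^ 2)
      (((y - s) ^ 2 + y) * Real.exp y) := by
  have h0 := hasSum_pow_div_factorial y
  have h1 : HasSum (fun m : ℕ => y ^ m / m.factorial * (m * 1)) (y * Real.exp y) :=
    hasSum_pow_div_factorial_mul_nat (c := fun _ => 1) (by simpa using h0)
  have h2 : HasSum (fun m : ℕ => y ^ m / m.factorial * (m * (m : ℝ)))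
      (y * (y * Real.exp y + Real.exp y)) := by
    refine hasSum_pow_div_factorial_mul_nat (c := fun m => (m : ℝ)) ?_
    refine (h1.add h0).congr_fun fun m => ?_
    push_cast
    ring
  have h3 := (h2.add (h1.mul_left (-2 * s))).add (h0.mul_left (s ^ 2))
  convert h3 using 1
  · funext m
    ring
  · ring

/-- Exponentially weighted first absolute central moment of the Poisson distribution. -/
theorem tsum_poisson_abs_le {t x : ℝ} (ht : 0 < t) (hx : 0 < x) :
    ∑' m : ℕ, ENNReal.ofReal ((t * x) ^ m / m.factorial * |m / t - 1|) ≤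
      ENNReal.ofReal (Real.exp (t * x) * ((1 / √t + √t * ((x - 1) ^ 2 + x / t)) / 2)) := by
  have hs : 0 < √t := Real.sqrt_pos.2 ht
  have hst : √t ^ 2 = t := Real.sq_sqrt ht.le
  have h := ((hasSum_pow_div_factorial (t * x)).mul_right (1 / √t / 2)).add
    ((hasSum_poisson_sq (t * x) t).mul_right (√t / t ^ 2 / 2))
  have hnn : ∀ m : ℕ, 0 ≤ (t * x) ^ m / m.factorial * (1 / √t / 2) +
      (t * x) ^ m / m.factorial * ((m : ℝ) - t) ^ 2 * (√t / t ^ 2 / 2) := fun m => by positivity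
  calc ∑' m : ℕ, ENNReal.ofReal ((t * x) ^ m / m.factorial * |m / t - 1|)
      ≤ ∑' m : ℕ, ENNReal.ofReal ((t * x) ^ m / m.factorial * (1 / √t / 2) +
          (t * x) ^ m / m.factorial * ((m : ℝ) - t) ^ 2 * (√t / t ^ 2 / 2)) := by
        refine ENNReal.tsum_le_tsum fun m => ENNReal.ofReal_le_ofReal ?_
        rw [mul_assoc, ← mul_add]
        refine mul_le_mul_of_nonneg_left ?_ (by positivity)
        have h1 : ((m : ℝ) - t) ^ 2 * (√t / t ^ 2 / 2) = √t * |m / t - 1| ^ 2 / 2 := by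
          rw [sq_abs]
          field_simp
        -- The inequality v ≤ 1/(2√t) + √t v²/2, balanced for the typical size t^{-1/2} of v = |m/t
        -- - 1|.
        have h2 : 0 ≤ (√t * |(m : ℝ) / t - 1| - 1) ^ 2 / √t / 2 := by positivity
        have h3 : (√t * |(m : ℝ) / t - 1| - 1) ^ 2 / √t / 2 =
            √t * |(m : ℝ) / t - 1| ^ 2 / 2 + 1 / √t / 2 - |(m : ℝ) / t - 1| := by
          field_simp
          ring
        rw [h1]
        linarith
    _ = _ := by
        rw [← ENNReal.ofReal_tsum_of_nonneg hnn h.summable, h.tsum_eq]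
        congr 1
        field_simp

end Moments

/-- The weights of `δ_right e^{tΔ}` in terms of pairs of Poisson variables. -/
noncomputable def gradWeight (t : ℝ) (z : ℕ × ℕ) : ℝ :=
  Real.exp (-2 * t) * (t ^ (z.1 + z.2) / (z.1.factorial * z.2.factorial)) * (z.1 / t - 1)

/-- Integration by parts for the Poisson law: shifting a to a + 1 in the series at n moves the
evaluation point to that of the series at n + 1 and multiplies the weight by a/t. Subtracting leaves
the factor a/t - 1. -/
theorem hasSum_gradWeight {f : ℤ → ℝ} (hf : ExpGrowth f) {t : ℝ} (ht : 0 < t) (n : ℤ) :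
    HasSum (fun z : ℕ × ℕ => gradWeight t z * f (n + (1 + z.2 - z.1)))
      (deltaRight (heatSemigroup t f) n) := by
  have h1 : ∀ k : ℤ, HasSum (fun z : ℕ × ℕ => Real.exp (-2 * t) *
      (t ^ (z.1 + z.2) / (z.1.factorial * z.2.factorial) * f (k - z.1 + z.2)))
      (heatSemigroup t f k) := fun k => by
    rw [hf.heatSemigroup_eq_tsum_pair]
    exact (hf.summable_pair t k).hasSum.mul_left _
  have h2 : HasSum (fun z : ℕ × ℕ => Real.exp (-2 * t) *
      (t ^ (z.1 + z.2) / (z.1.factorial * z.2.factorial) * (z.1 / t) * f (n + 1 - z.1 + z.2)))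
      (heatSemigroup t f n) := by
    -- The pairs missed by the shift have first entry 0, where the factor a/t vanishes.
    have hinj : Function.Injective fun z : ℕ × ℕ => (z.1 + 1, z.2) := fun z w h => by
      simp only [Prod.mk.injEq, Nat.add_right_cancel_iff] at h
      exact Prod.ext h.1 h.2
    refine (hinj.hasSum_iff ?_).1 ((h1 n).congr_fun fun z => ?_)
    · rintro ⟨a, b⟩ hab
      rcases a with _ | a
      · simp
      · exact absurd ⟨(a, b), rfl⟩ hab
    · simp only [Function.comp_apply]
      rw [Nat.factorial_succ]
      have : n + 1 - ((z.1 + 1 : ℕ) : ℤ) + z.2 = n - z.1 + z.2 := by push_cast; ring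
      rw [this]
      push_cast
      field_simp
      ring
  refine (h2.sub (h1 (n + 1))).congr_fun fun z => ?_
  rw [gradWeight, show n + (1 + (z.2 : ℤ) - z.1) = n + 1 - z.1 + z.2 by ring]
  ring

/-- The exponentially weighted total mass of `gradWeight`. -/
noncomputable def gradMass (t l : ℝ) : ℝ≥0∞ :=
  ∑' z : ℕ × ℕ, ENNReal.ofReal (|gradWeight t z| * Real.exp (l * |(1 + z.2 - z.1 : ℝ)|))

theorem tsum_prod_ofReal {A B : ℕ → ℝ} (hA : ∀ m, 0 ≤ A m) :
    ∑' z : ℕ × ℕ, ENNReal.ofReal (A z.1 * B z.2) =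
      (∑' m, ENNReal.ofReal (A m)) * ∑' b, ENNReal.ofReal (B b) := by
  rw [ENNReal.tsum_prod', ← ENNReal.tsum_mul_right]
  refine tsum_congr fun m => ?_
  rw [← ENNReal.tsum_mul_left]
  exact tsum_congr fun b => ENNReal.ofReal_mul (hA m)

/-- Tilting by e^{±l} replaces the two Poisson means t by t e^{±l}. The total exponent t(e^l +
e^{-l} - 2) is at most 4 l² t, which stays bounded because |l| √t ≤ 1; the tilted moment keeps the
order t^{-1/2}. -/
theorem tsum_one_sided_le {t l : ℝ} (ht : 0 < t) (hl : |l| ≤ 1) (hlt : |l| * √t ≤ 1) :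
    ∑' z : ℕ × ℕ, ENNReal.ofReal (Real.exp (-2 * t) *
      (((t * Real.exp l) ^ z.1 / z.1.factorial * |z.1 / t - 1|) *
        ((t * Real.exp (-l)) ^ z.2 / z.2.factorial))) ≤
      ENNReal.ofReal (4 * Real.exp 4 / √t) := by
  have hs : 0 < √t := Real.sqrt_pos.2 ht
  have hst : √t ^ 2 = t := Real.sq_sqrt ht.le
  have hB : ∑' b : ℕ, ENNReal.ofReal ((t * Real.exp (-l)) ^ b / b.factorial) =
      ENNReal.ofReal (Real.exp (t * Real.exp (-l))) := by
    rw [← ENNReal.ofReal_tsum_of_nonneg (fun b => by positivity)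
      (hasSum_pow_div_factorial _).summable, (hasSum_pow_div_factorial _).tsum_eq]
  simp only [ENNReal.ofReal_mul (Real.exp_pos (-2 * t)).le]
  rw [ENNReal.tsum_mul_left, tsum_prod_ofReal (A := fun m : ℕ => (t * Real.exp l) ^ m /
    m.factorial * |m / t - 1|) (B := fun b : ℕ => (t * Real.exp (-l)) ^ b / b.factorial)
    (fun m => by positivity), hB]
  refine (mul_le_mul' le_rfl (mul_le_mul' (tsum_poisson_abs_le ht (Real.exp_pos l))
    le_rfl)).trans ?_
  rw [← ENNReal.ofReal_mul (by positivity), ← ENNReal.ofReal_mul (by positivity)]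
  refine ENNReal.ofReal_le_ofReal ?_
  have h1 : |Real.exp l - 1| ≤ 2 * |l| := Real.abs_exp_sub_one_le hl
  have h1' : |Real.exp (-l) - 1| ≤ 2 * |l| := by
    simpa using Real.abs_exp_sub_one_le (x := -l) (by simpa using hl)
  have hl2 : |l| ^ 2 * t ≤ 1 := by
    rw [← hst, ← mul_pow]
    exact pow_le_one₀ (by positivity) hlt
  have h2 : (Real.exp l - 1) ^ 2 ≤ 4 / t := by
    rw [le_div_iff₀ ht, ← sq_abs]
    have : |Real.exp l - 1| ^ 2 ≤ (2 * |l|) ^ 2 := by gcongr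
    nlinarith
  have h3 : Real.exp l ≤ 3 := by
    have := abs_le.1 h1
    linarith
  have h4 : t * Real.exp l + t * Real.exp (-l) - 2 * t ≤ 4 := by
    have h5 : Real.exp l * Real.exp (-l) = 1 := by rw [← Real.exp_add]; simp
    have h6 : t * Real.exp l + t * Real.exp (-l) - 2 * t =
        t * -((Real.exp l - 1) * (Real.exp (-l) - 1)) := by linear_combination t * h5
    rw [h6]
    have h7 : -((Real.exp l - 1) * (Real.exp (-l) - 1)) ≤ (2 * |l|) * (2 * |l|) := by
      refine (neg_le_abs _).trans ?_
      rw [abs_mul]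
      gcongr
    nlinarith
  -- The three contributions are 1, 4 and 3 in units of 1/√t, and half their sum is 4.
  have h8 : (1 / √t + √t * ((Real.exp l - 1) ^ 2 + Real.exp l / t)) / 2 ≤ 4 / √t := by
    calc _ ≤ (1 / √t + √t * (4 / t + 3 / t)) / 2 := by gcongr
      _ = 4 / √t := by
        rw [← add_div]
        nth_rewrite 3 [← hst]
        field_simp
        norm_num
  calc Real.exp (-2 * t) * (Real.exp (t * Real.exp l) *
        ((1 / √t + √t * ((Real.exp l - 1) ^ 2 + Real.exp l / t)) / 2) *
          Real.exp (t * Real.exp (-l)))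
      = Real.exp (t * Real.exp l + t * Real.exp (-l) - 2 * t) *
        ((1 / √t + √t * ((Real.exp l - 1) ^ 2 + Real.exp l / t)) / 2) := by
        rw [show t * Real.exp l + t * Real.exp (-l) - 2 * t =
          -2 * t + t * Real.exp l + t * Real.exp (-l) by ring, Real.exp_add, Real.exp_add]
        ring
    _ ≤ Real.exp 4 * (4 / √t) := by gcongr
    _ = _ := by ring

theorem gradMass_le {t l : ℝ} (ht : 0 < t) (hl0 : 0 ≤ l) (hl : l ≤ 1) (hlt : l * √t ≤ 1) :
    gradMass t l ≤ ENNReal.ofReal (24 * Real.exp 4 / √t) := by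
  have hs : 0 < √t := Real.sqrt_pos.2 ht
  have h1 := tsum_one_sided_le ht (l := l) (by rwa [abs_of_nonneg hl0])
    (by rwa [abs_of_nonneg hl0])
  have h2 := tsum_one_sided_le ht (l := -l) (by rwa [abs_neg, abs_of_nonneg hl0])
    (by rwa [abs_neg, abs_of_nonneg hl0])
  have he : Real.exp l ≤ 3 := by
    have := Real.abs_exp_sub_one_le (x := l) (by rwa [abs_of_nonneg hl0])
    rw [abs_of_nonneg hl0] at this
    have := abs_le.1 this
    linarith
  have hsum := add_le_add h1 h2
  rw [← ENNReal.tsum_add, ← ENNReal.ofReal_add (by positivity) (by positivity)] at hsum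
  calc gradMass t l ≤ ∑' z : ℕ × ℕ, ENNReal.ofReal 3 * (ENNReal.ofReal (Real.exp (-2 * t) *
      (((t * Real.exp l) ^ z.1 / z.1.factorial * |z.1 / t - 1|) *
        ((t * Real.exp (-l)) ^ z.2 / z.2.factorial))) + ENNReal.ofReal (Real.exp (-2 * t) *
      (((t * Real.exp (-l)) ^ z.1 / z.1.factorial * |z.1 / t - 1|) *
        ((t * Real.exp (- -l)) ^ z.2 / z.2.factorial)))) := by
        refine ENNReal.tsum_le_tsum fun z => ?_
        rw [← ENNReal.ofReal_add (by positivity) (by positivity),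
          ← ENNReal.ofReal_mul (by norm_num)]
        refine ENNReal.ofReal_le_ofReal ?_
        -- The two-sided weight is bounded by the two one-sided tilts; the shift by 1 costs e^l ≤ 3.
        -- Hence the constant 24 = 3 · (4 + 4).
        have habs : Real.exp (l * |(1 + z.2 - z.1 : ℝ)|) ≤
            3 * (Real.exp l ^ z.1 * Real.exp (-l) ^ z.2 +
              Real.exp (-l) ^ z.1 * Real.exp (- -l) ^ z.2) := by
          simp only [← Real.exp_nat_mul, ← Real.exp_add]
          calc Real.exp (l * |(1 + z.2 - z.1 : ℝ)|)
              ≤ Real.exp (l + |l * (z.2 - z.1)|) := by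
                refine Real.exp_le_exp.2 ?_
                rw [abs_mul, abs_of_nonneg hl0, ← mul_one_add]
                gcongr
                rw [add_sub_assoc]
                exact (abs_add_le _ _).trans (by simp)
            _ = Real.exp l * Real.exp |l * (z.2 - z.1)| := Real.exp_add _ _
            _ ≤ 3 * (Real.exp (l * (z.2 - z.1)) + Real.exp (-(l * (z.2 - z.1)))) := by
                gcongr
                rcases abs_cases (l * ((z.2 : ℝ) - z.1)) with h | h <;> rw [h.1]
                · linarith [Real.exp_pos (-(l * ((z.2 : ℝ) - z.1)))]
                · linarith [Real.exp_pos (l * ((z.2 : ℝ) - z.1))]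
            _ = _ := by
                rw [add_comm]
                congr 3 <;> ring
        have hg : |gradWeight t z| = Real.exp (-2 * t) *
            (t ^ (z.1 + z.2) / (z.1.factorial * z.2.factorial)) * |z.1 / t - 1| := by
          rw [gradWeight, abs_mul, abs_of_nonneg (by positivity)]
        rw [hg]
        refine (mul_le_mul_of_nonneg_left habs (by positivity)).trans (le_of_eq ?_)
        simp only [mul_pow, pow_add]
        field_simp
    _ ≤ ENNReal.ofReal 3 * ENNReal.ofReal (4 * Real.exp 4 / √t + 4 * Real.exp 4 / √t) := by
        rw [ENNReal.tsum_mul_left]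
        gcongr
    _ = _ := by
        rw [← ENNReal.ofReal_mul (by norm_num)]
        congr 1
        ring

theorem enorm_deltaRight_heatSemigroup_le {f : ℤ → ℝ} (hf : ExpGrowth f) {t : ℝ}
    (ht : 0 < t) (n : ℤ) :
    ‖deltaRight (heatSemigroup t f) n‖ₑ ≤
      ∑' z : ℕ × ℕ, ‖gradWeight t z‖ₑ * ‖f (n + (1 + z.2 - z.1))‖ₑ := by
  rw [← (hasSum_gradWeight hf ht n).tsum_eq]
  refine enorm_tsum_le_tsum_enorm.trans (le_of_eq ?_)
  simp only [enorm_mul]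

theorem eLpNorm_comp_add {p : ℝ≥0∞} {E : Type*} [TopologicalSpace E] [ContinuousENorm E]
    (g : ℤ → E) (k : ℤ) :
    eLpNorm (fun n => g (n + k)) p Measure.count = eLpNorm g p (Measure.count : Measure ℤ) := by
  have : MeasurePreserving (fun n : ℤ => n + k) Measure.count Measure.count :=
    measurePreserving_add_right _ k
  exact eLpNorm_comp_measurePreserving (g := g)
    (StronglyMeasurable.of_discrete).aestronglyMeasurable this

/-- The gradient estimate `‖δ_right e^{tΔ} f‖_p ≤ C t^{-1/2} ‖f‖_p`. -/
theorem eLpNorm_deltaRight_heatSemigroup_le {f : ℤ → ℝ} (hf : ExpGrowth f) {t : ℝ}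
    (ht : 0 < t) {p : ℝ≥0∞} (hp : 1 ≤ p) :
    eLpNorm (deltaRight (heatSemigroup t f)) p Measure.count ≤
      ENNReal.ofReal (24 * Real.exp 4 / √t) * eLpNorm f p (Measure.count : Measure ℤ) := by
  calc eLpNorm (deltaRight (heatSemigroup t f)) p Measure.count
      ≤ eLpNorm (fun n => ∑' z : ℕ × ℕ, ‖gradWeight t z‖ₑ * ‖f (n + (1 + z.2 - z.1))‖ₑ) p
          (Measure.count : Measure ℤ) :=
        eLpNorm_mono_enorm fun n => enorm_deltaRight_heatSemigroup_le hf ht n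
    _ ≤ ∑' z : ℕ × ℕ, eLpNorm (fun n => ‖gradWeight t z‖ₑ * ‖f (n + (1 + z.2 - z.1))‖ₑ) p
          (Measure.count : Measure ℤ) :=
        eLpNorm_count_tsum_le hp (fun (z : ℕ × ℕ) n =>
          ‖gradWeight t z‖ₑ * ‖f (n + (1 + z.2 - z.1))‖ₑ)
    _ ≤ ∑' z : ℕ × ℕ, ‖gradWeight t z‖ₑ * eLpNorm f p (Measure.count : Measure ℤ) := by
        refine ENNReal.tsum_le_tsum fun z => ?_
        rw [← eLpNorm_comp_add f (1 + z.2 - z.1)]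
        refine eLpNorm_le_mul_eLpNorm_of_ae_le_mul'' p
          (StronglyMeasurable.of_discrete).aestronglyMeasurable (Filter.Eventually.of_forall fun n => ?_)
        rw [enorm_eq_self]
    _ = gradMass t 0 * eLpNorm f p (Measure.count : Measure ℤ) := by
        rw [ENNReal.tsum_mul_right, gradMass]
        congr 1
        refine tsum_congr fun z => ?_
        rw [Real.enorm_eq_ofReal_abs]
        simp
    _ ≤ _ := by
        gcongr
        exact gradMass_le ht le_rfl zero_le_one (by simp)

/-! ### Exponential decay of the differences of the heat kernel -/

/-- The exponentially weighted `ℓ¹` norm. -/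
noncomputable def expNorm (l : ℝ) (f : ℤ → ℝ) : ℝ≥0∞ :=
  ∑' n : ℤ, ENNReal.ofReal (Real.exp (l * |(n : ℝ)|)) * ‖f n‖ₑ

/-- The weight satisfies e^{l|n|} ≤ e^{l|k|} e^{l|n+k|}, so this is Young's inequality with the
weighted mass `gradMass t l`. -/
theorem expNorm_deltaRight_heatSemigroup_le {f : ℤ → ℝ} (hf : ExpGrowth f) {t l : ℝ}
    (ht : 0 < t) (hl0 : 0 ≤ l) (hl : l ≤ 1) (hlt : l * √t ≤ 1) :
    expNorm l (deltaRight (heatSemigroup t f)) ≤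
      ENNReal.ofReal (24 * Real.exp 4 / √t) * expNorm l f := by
  calc expNorm l (deltaRight (heatSemigroup t f))
      ≤ ∑' n : ℤ, ∑' z : ℕ × ℕ, ENNReal.ofReal (Real.exp (l * |(n : ℝ)|)) *
          (‖gradWeight t z‖ₑ * ‖f (n + (1 + z.2 - z.1))‖ₑ) := by
        refine ENNReal.tsum_le_tsum fun n => ?_
        rw [ENNReal.tsum_mul_left]
        gcongr
        exact enorm_deltaRight_heatSemigroup_le hf ht n
    _ = ∑' z : ℕ × ℕ, ∑' n : ℤ, ENNReal.ofReal (Real.exp (l * |(n : ℝ)|)) *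
          (‖gradWeight t z‖ₑ * ‖f (n + (1 + z.2 - z.1))‖ₑ) := ENNReal.tsum_comm
    _ ≤ ∑' z : ℕ × ℕ, ENNReal.ofReal (|gradWeight t z| * Real.exp (l * |(1 + z.2 - z.1 : ℝ)|)) *
          expNorm l f := by
        refine ENNReal.tsum_le_tsum fun z => ?_
        set k : ℤ := 1 + z.2 - z.1 with hk
        have hk' : (1 + z.2 - z.1 : ℝ) = (k : ℝ) := by rw [hk]; push_cast; rfl
        rw [hk', expNorm, ← ENNReal.tsum_mul_left,
          ← (Equiv.addRight k).tsum_eq (fun n : ℤ => ENNReal.ofReal (|gradWeight t z| *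
            Real.exp (l * |(k : ℝ)|)) * (ENNReal.ofReal (Real.exp (l * |(n : ℝ)|)) * ‖f n‖ₑ))]
        refine ENNReal.tsum_le_tsum fun n => ?_
        simp only [Equiv.coe_addRight]
        rw [Real.enorm_eq_ofReal_abs (gradWeight t z), ← mul_assoc, ← mul_assoc,
          ← ENNReal.ofReal_mul (by positivity), ← ENNReal.ofReal_mul (by positivity)]
        gcongr ENNReal.ofReal ?_ * _
        rw [mul_comm (Real.exp _), mul_assoc, ← Real.exp_add, ← mul_add]
        gcongr
        push_cast
        have := abs_sub_abs_le_abs_sub ((n : ℝ)) ((n : ℝ) + k)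
        rw [sub_add_cancel_left, abs_neg] at this
        linarith
    _ = gradMass t l * expNorm l f := by rw [ENNReal.tsum_mul_right, gradMass]
    _ ≤ _ := by
        gcongr
        exact gradMass_le ht hl0 hl hlt

theorem heatSemigroup_iterate_deltaRight {f : ℤ → ℝ} (hf : ExpGrowth f) (t : ℝ) (l : ℕ) :
    heatSemigroup t (deltaRight^[l] f) = deltaRight^[l] (heatSemigroup t f) := by
  induction l with
  | zero => rfl
  | succ l ih => rw [Function.iterate_succ_apply', (hf.iterate_deltaRight l).heatSemigroup_deltaRight,
      ih, Function.iterate_succ_apply']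

theorem expGrowth_single : ExpGrowth (Pi.single 0 1) :=
  ⟨1, fun j => by
    rcases eq_or_ne j 0 with rfl | hj
    · simp
    · simp [hj, Real.exp_nonneg]⟩

theorem heatSemigroup_single (t : ℝ) : heatSemigroup t (Pi.single 0 1) = heatKernel t := by
  funext n
  rw [heatSemigroup, tsum_eq_single 0 fun j hj => by simp [hj]]
  simp

theorem expGrowth_heatKernel (t : ℝ) : ExpGrowth (heatKernel t) := by
  rw [← heatSemigroup_single]
  exact expGrowth_single.heatSemigroup t

theorem heatSemigroup_heatKernel (s t : ℝ) : heatSemigroup s (heatKernel t) = heatKernel (s + t) := by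
  rw [← heatSemigroup_single, expGrowth_single.heatSemigroup_semigroup, heatSemigroup_single]

theorem summable_heatKernel (t : ℝ) : Summable (heatKernel t) := by
  have hone : ExpGrowth fun _ => (1 : ℝ) := ⟨1, fun j => by simp⟩
  have h := (hone.hasSum_heatKernel t 0).summable
  simp only [mul_one] at h
  refine ((Equiv.subLeft (0 : ℤ)).summable_iff).1 (h.congr fun j => ?_)
  simp

theorem summable_iterate_deltaRight {g : ℤ → ℝ} (hg : Summable g) (l : ℕ) :
    Summable (deltaRight^[l] g) := by
  induction l with
  | zero => exact hg
  | succ l ih =>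
    rw [Function.iterate_succ_apply']
    exact ih.sub ((Equiv.addRight (1 : ℤ)).summable_iff.2 ih)

theorem expNorm_single (l : ℝ) : expNorm l (Pi.single 0 1) = 1 := by
  rw [expNorm, tsum_eq_single 0 fun j hj => by simp [hj]]
  simp

theorem exists_expNorm_heatKernel_le (l : ℕ) : ∃ C : ℝ, 0 ≤ C ∧ ∀ t a : ℝ, 0 < t → 0 ≤ a → a ≤ 1 →
    a * √t ≤ 1 → expNorm a (deltaRight^[l + 1] (heatKernel t)) ≤ ENNReal.ofReal (C / √t ^ (l + 1)) := by
  induction l with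
  | zero =>
    refine ⟨24 * Real.exp 4, by positivity, fun t a ht ha0 ha hat => ?_⟩
    have h := expNorm_deltaRight_heatSemigroup_le expGrowth_single ht ha0 ha hat
    rw [expNorm_single, mul_one, heatSemigroup_single] at h
    simpa using h
  | succ l ih =>
    obtain ⟨C, hC, h⟩ := ih
    refine ⟨24 * Real.exp 4 * C * √2 ^ (l + 2), by positivity, fun t a ht ha0 ha hat => ?_⟩
    have ht2 : 0 < t / 2 := by positivity
    have hat2 : a * √(t / 2) ≤ 1 := by
      refine le_trans ?_ hat
      gcongr
      linarith
    -- The time is halved: one difference is spent on e^{(t/2)Δ_d}, the others on the kernel at time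
    -- t/2.
    have heq : deltaRight^[l + 1 + 1] (heatKernel t) =
        deltaRight (heatSemigroup (t / 2) (deltaRight^[l + 1] (heatKernel (t / 2)))) := by
      rw [heatSemigroup_iterate_deltaRight (expGrowth_heatKernel _), heatSemigroup_heatKernel,
        add_halves, Function.iterate_succ_apply']
    rw [heq]
    refine (expNorm_deltaRight_heatSemigroup_le ((expGrowth_heatKernel _).iterate_deltaRight _)
      ht2 ha0 ha hat2).trans ?_
    refine (mul_le_mul' le_rfl (h _ a ht2 ha0 ha hat2)).trans (le_of_eq ?_)
    rw [← ENNReal.ofReal_mul (by positivity), Real.sqrt_div ht.le]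
    congr 1
    have : 0 < √t := Real.sqrt_pos.2 ht
    have : 0 < √(2 : ℝ) := by positivity
    rw [div_pow]
    field_simp
    ring

/-- A sequence tending to zero is controlled by its variation. -/
theorem enorm_le_tsum_enorm_sub {a : ℕ → ℝ} (ha : Filter.Tendsto a Filter.atTop (nhds 0)) :
    ‖a 0‖ₑ ≤ ∑' j, ‖a j - a (j + 1)‖ₑ := by
  have h1 : ∀ N : ℕ, ‖a 0‖ₑ ≤ (∑' j, ‖a j - a (j + 1)‖ₑ) + ‖a N‖ₑ := fun N => by
    have h2 : a 0 = (∑ j ∈ Finset.range N, (a j - a (j + 1))) + a N := by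
      rw [Finset.sum_range_sub']
      ring
    rw [h2]
    refine (enorm_add_le _ _).trans (add_le_add ?_ le_rfl)
    exact (enorm_sum_le _ _).trans (ENNReal.sum_le_tsum _)
  have h3 : Filter.Tendsto (fun N => (∑' j, ‖a j - a (j + 1)‖ₑ) + ‖a N‖ₑ) Filter.atTop
      (nhds ((∑' j, ‖a j - a (j + 1)‖ₑ) + 0)) := by
    refine tendsto_const_nhds.add ?_
    have h := (continuous_enorm.tendsto (0 : ℝ)).comp ha
    rw [enorm_zero] at h
    exact h
  rw [add_zero] at h3
  exact ge_of_tendsto' h3 h1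

/-- g tends to zero at infinity, so g(n) telescopes along the half-line from n away from the origin.
The weight along that path is at least its value at n. -/
theorem exp_mul_enorm_le_expNorm {g : ℤ → ℝ} (hg : Summable g) {a : ℝ} (ha : 0 ≤ a) (n : ℤ) :
    ENNReal.ofReal (Real.exp (a * |(n : ℝ)|)) * ‖g n‖ₑ ≤ expNorm a (deltaRight g) := by
  rcases le_total 0 n with hn | hn
  · have hinj : Function.Injective fun j : ℕ => n + (j : ℤ) := fun i j h => by simpa using h
    have h1 := enorm_le_tsum_enorm_sub (a := fun j : ℕ => g (n + j))
      ((hg.comp_injective hinj).tendsto_atTop_zero)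
    simp only [Nat.cast_zero, add_zero] at h1
    refine (mul_le_mul' le_rfl h1).trans ?_
    rw [← ENNReal.tsum_mul_left]
    refine le_trans (ENNReal.tsum_le_tsum fun j => ?_) (ENNReal.tsum_comp_le_tsum_of_injective hinj
      fun k => ENNReal.ofReal (Real.exp (a * |(k : ℝ)|)) * ‖deltaRight g k‖ₑ)
    have hn' : (0 : ℝ) ≤ n := by exact_mod_cast hn
    have : |(n : ℝ)| ≤ |((n + (j : ℤ) : ℤ) : ℝ)| := by
      push_cast
      rw [abs_of_nonneg hn', abs_of_nonneg (by positivity)]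
      simp
    simp only [deltaRight, Nat.cast_add, Nat.cast_one, add_assoc]
    gcongr
  · have hinj : Function.Injective fun j : ℕ => n - (j : ℤ) := fun i j h => by simpa using h
    have hinj' : Function.Injective fun j : ℕ => n - (j : ℤ) - 1 := fun i j h => by simpa using h
    have h1 := enorm_le_tsum_enorm_sub (a := fun j : ℕ => g (n - j))
      ((hg.comp_injective hinj).tendsto_atTop_zero)
    simp only [Nat.cast_zero, sub_zero] at h1
    refine (mul_le_mul' le_rfl h1).trans ?_
    rw [← ENNReal.tsum_mul_left]
    refine le_trans (ENNReal.tsum_le_tsum fun j => ?_) (ENNReal.tsum_comp_le_tsum_of_injective hinj'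
      fun k => ENNReal.ofReal (Real.exp (a * |(k : ℝ)|)) * ‖deltaRight g k‖ₑ)
    have hn' : (n : ℝ) ≤ 0 := by exact_mod_cast hn
    have hj : (0 : ℝ) ≤ j := j.cast_nonneg
    have : |(n : ℝ)| ≤ |((n - (j : ℤ) - 1 : ℤ) : ℝ)| := by
      push_cast
      rw [abs_of_nonpos hn', abs_of_nonpos (by linarith)]
      linarith
    have h2 : ‖g (n - j) - g (n - (j + 1 : ℕ))‖ₑ = ‖deltaRight g (n - j - 1)‖ₑ := by
      rw [deltaRight, sub_add_cancel, ← enorm_neg, neg_sub, Nat.cast_add, Nat.cast_one, sub_sub]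
    rw [h2]
    gcongr

/-- Pointwise bounds for the differences of the heat kernel. -/
theorem exists_enorm_iterate_deltaRight_heatKernel_le (l : ℕ) : ∃ C : ℝ, 0 ≤ C ∧ ∀ t : ℝ, 1 ≤ t →
    ∀ n : ℤ, ‖deltaRight^[l] (heatKernel t) n‖ₑ ≤
      ENNReal.ofReal (C / √t ^ (l + 1)) * ENNReal.ofReal (Real.exp (-(|(n : ℝ)| / √t))) := by
  obtain ⟨C, hC, h⟩ := exists_expNorm_heatKernel_le l
  refine ⟨C, hC, fun t ht n => ?_⟩
  have ht0 : 0 < t := by linarith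
  have hs : 1 ≤ √t := Real.one_le_sqrt.2 ht
  have hs0 : 0 < √t := by linarith
  -- The rate 1/√t is the largest one allowed by a √t ≤ 1; the other constraint a ≤ 1 is where t ≥ 1
  -- is needed.
  have h1 := h t (1 / √t) ht0 (by positivity) ((div_le_one hs0).2 hs) (by field_simp; rfl)
  rw [Function.iterate_succ_apply'] at h1
  have h2 := (exp_mul_enorm_le_expNorm (summable_iterate_deltaRight (summable_heatKernel t) l)
    (by positivity : 0 ≤ 1 / √t) n).trans h1
  calc ‖deltaRight^[l] (heatKernel t) n‖ₑ
      = (ENNReal.ofReal (Real.exp (1 / √t * |(n : ℝ)|)) * ‖deltaRight^[l] (heatKernel t) n‖ₑ) *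
        ENNReal.ofReal (Real.exp (-(|(n : ℝ)| / √t))) := by
        rw [mul_right_comm, ← ENNReal.ofReal_mul (by positivity), ← Real.exp_add,
          show 1 / √t * |(n : ℝ)| + -(|(n : ℝ)| / √t) = 0 by ring]
        simp
    _ ≤ _ := by gcongr

theorem hasSum_iterate_deltaRight_heatKernel {f : ℤ → ℝ} (hf : ExpGrowth f) (t : ℝ) (l : ℕ) (n : ℤ) :
    HasSum (fun j : ℤ => deltaRight^[l] (heatKernel t) (n - j) * f j)
      (deltaRight^[l] (heatSemigroup t f) n) := by
  induction l generalizing n with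
  | zero => exact hf.hasSum_heatKernel t n
  | succ l ih =>
    simp only [Function.iterate_succ_apply']
    refine ((ih n).sub (ih (n + 1))).congr_fun fun j => ?_
    rw [deltaRight, sub_mul, sub_add_eq_add_sub]

theorem exists_enorm_heatSemigroup_iterate_deltaRight_le (l : ℕ) : ∃ C : ℝ, 0 ≤ C ∧
    ∀ f : ℤ → ℝ, ExpGrowth f → ∀ t : ℝ, 1 ≤ t → ∀ n : ℤ,
      ‖heatSemigroup t (deltaRight^[l] f) n‖ₑ ≤ ENNReal.ofReal (C / √t ^ (l + 1)) *
        ∑' j : ℤ, ENNReal.ofReal (Real.exp (-(|(n : ℝ) - j| / √t))) * ‖f j‖ₑ := by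
  obtain ⟨C, hC, h⟩ := exists_enorm_iterate_deltaRight_heatKernel_le l
  refine ⟨C, hC, fun f hf t ht n => ?_⟩
  rw [heatSemigroup_iterate_deltaRight hf, ← (hasSum_iterate_deltaRight_heatKernel hf t l n).tsum_eq,
    ← ENNReal.tsum_mul_left]
  refine enorm_tsum_le_tsum_enorm.trans (ENNReal.tsum_le_tsum fun j => ?_)
  rw [enorm_mul, ← mul_assoc]
  gcongr
  simpa using h t ht (n - j)

/-! ### Besov seminorms with different numbers of differences -/

/-- The function `t ↦ t^{(l-α)/2} ‖e^{tΔ} δ_right^l f‖_p`. -/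
noncomputable def gradNorm (l : ℕ) (α : ℝ) (p : ℝ≥0∞) (f : ℤ → ℝ) (t : ℝ) : ℝ≥0∞ :=
  ENNReal.ofReal (t ^ ((l - α) / 2)) *
    eLpNorm (heatSemigroup t (deltaRight^[l] f)) p (Measure.count : Measure ℤ)

/-- The Besov seminorm with `l` differences. -/
noncomputable def besovNorm (l : ℕ) (α : ℝ) (p q : ℝ≥0∞) (f : ℤ → ℝ) : ℝ≥0∞ :=
  eLpNorm (gradNorm l α p f) q dtOverT

theorem measurable_gradNorm {l : ℕ} {α : ℝ} {p : ℝ≥0∞} (hp : 1 ≤ p) {f : ℤ → ℝ} (hf : ExpGrowth f) :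
    Measurable (gradNorm l α p f) := by
  unfold gradNorm
  refine Measurable.mul (by fun_prop) ?_
  have h := measurable_eLpNorm_count (ι := ℤ) (zero_lt_one.trans_le hp).ne'
    (F := fun t n => ‖heatSemigroup t (deltaRight^[l] f) n‖ₑ)
    (fun n => ((hf.iterate_deltaRight l).continuous_heatSemigroup n).enorm.measurable)
  simpa only [eLpNorm_enorm] using h

theorem eLpNorm_translate (k : ℤ) (g : ℤ → ℝ) (p : ℝ≥0∞) :
    eLpNorm (translate k g) p Measure.count = eLpNorm g p (Measure.count : Measure ℤ) :=
  eLpNorm_comp_add g k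

theorem heatSemigroup_translate' (t : ℝ) (k : ℤ) (g : ℤ → ℝ) :
    heatSemigroup t (translate k g) = translate k (heatSemigroup t g) :=
  funext fun n => heatSemigroup_translate t g k n

theorem ratioKernel_of_le {a x y : ℝ} (hx : 0 < x) (hxy : x ≤ y) :
    ratioKernel a x y = ENNReal.ofReal ((x / y) ^ a) := by
  rw [ratioKernel, min_eq_left]
  exact ((div_le_one (hx.trans_le hxy)).2 hxy).trans ((one_le_div hx).2 hxy)

theorem ratioKernel_sqrt_of_le {a s t : ℝ} (ht : 0 < t) (hts : t ≤ s) :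
    ratioKernel a √t √s = ENNReal.ofReal ((t / s) ^ (a / 2)) := by
  rw [ratioKernel_of_le (Real.sqrt_pos.2 ht) (Real.sqrt_le_sqrt hts), ← Real.sqrt_div ht.le,
    Real.sqrt_eq_rpow, ← Real.rpow_mul (div_nonneg ht.le (ht.trans_le hts).le)]
  congr 2
  ring

theorem eLpNorm_iterate_succ_le {f : ℤ → ℝ} (hf : ExpGrowth f) (l : ℕ) {p : ℝ≥0∞} (hp : 1 ≤ p)
    {s t : ℝ} (hs : 0 < s) (hst : 2 * s ≤ t) :
    eLpNorm (heatSemigroup t (deltaRight^[l + 1] f)) p (Measure.count : Measure ℤ) ≤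
      ENNReal.ofReal (24 * Real.exp 4 * √2 / √t) *
        eLpNorm (heatSemigroup s (deltaRight^[l] f)) p (Measure.count : Measure ℤ) := by
  have hl := hf.iterate_deltaRight l
  have ht : 0 < t := by linarith
  have h1 : heatSemigroup t (deltaRight^[l + 1] f) =
      deltaRight (heatSemigroup (t - s) (heatSemigroup s (deltaRight^[l] f))) := by
    rw [hl.heatSemigroup_semigroup, sub_add_cancel, Function.iterate_succ_apply',
      hl.heatSemigroup_deltaRight]
  rw [h1]
  refine (eLpNorm_deltaRight_heatSemigroup_le (hl.heatSemigroup s) (by linarith) hp).trans ?_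
  gcongr ENNReal.ofReal ?_ * _
  -- The remaining time t - s is at least t/2.
  have h2 : √t ≤ √2 * √(t - s) := by
    rw [← Real.sqrt_mul zero_le_two]
    exact Real.sqrt_le_sqrt (by linarith)
  have h3 : 0 < √(t - s) := Real.sqrt_pos.2 (by linarith)
  have h4 : 0 < √t := Real.sqrt_pos.2 ht
  rw [div_le_div_iff₀ h3 h4, mul_assoc _ √2]
  gcongr

theorem rpow_le_of_ratio {s t : ℝ} (hs : 0 < s) (hst : s ≤ t) (hts : t ≤ 4 * s) (c : ℝ) :
    t ^ c ≤ 4 ^ |c| * s ^ c := by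
  have h1 : 1 ≤ t / s := (one_le_div hs).2 hst
  have h2 : t / s ≤ 4 := (div_le_iff₀ hs).2 hts
  have ht : t ^ c = (t / s) ^ c * s ^ c := by
    rw [← Real.mul_rpow (by positivity) hs.le, div_mul_cancel₀ _ hs.ne']
  rw [ht]
  gcongr
  calc (t / s) ^ c ≤ (t / s) ^ |c| := Real.rpow_le_rpow_of_exponent_le h1 (le_abs_self c)
    _ ≤ 4 ^ |c| := by gcongr

/-- The seminorm with more differences is controlled by the one with fewer. -/
theorem besovNorm_succ_lt_top {f : ℤ → ℝ} (hf : ExpGrowth f) {l : ℕ} {α : ℝ} {p q : ℝ≥0∞}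
    (hp : 1 ≤ p) (hq : 1 ≤ q) (h : besovNorm l α p q f < ∞) : besovNorm (l + 1) α p q f < ∞ := by
  obtain ⟨C, hC, hschur⟩ := logSize_sqrt.eLpNorm_le logSize_sqrt (a := 1) one_pos
  set D : ℝ := 24 * Real.exp 4 * √2 * 4 ^ |((l : ℝ) - α) / 2| with hD
  have hD0 : 0 ≤ D := by positivity
  have hpt : ∀ t s : ℝ, 0 < t → s ∈ Icc (t / 4) (t / 2) →
      gradNorm (l + 1) α p f t ≤ ENNReal.ofReal D * gradNorm l α p f s := by
    intro t s ht hs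
    have hs0 : 0 < s := by linarith [hs.1]
    have ht0 : 0 < √t := Real.sqrt_pos.2 ht
    rw [gradNorm, gradNorm]
    refine (mul_le_mul' le_rfl (eLpNorm_iterate_succ_le hf l hp hs0 (by linarith [hs.2]))).trans ?_
    rw [← mul_assoc, ← mul_assoc, ← ENNReal.ofReal_mul (by positivity), ← ENNReal.ofReal_mul hD0]
    gcongr ENNReal.ofReal ?_ * _
    have h1 := rpow_le_of_ratio hs0 (by linarith [hs.2]) (by linarith [hs.1] : t ≤ 4 * s)
      (((l : ℝ) - α) / 2)
    have h2 : t ^ (((l + 1 : ℕ) - α) / 2) = t ^ (((l : ℝ) - α) / 2) * √t := by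
      rw [Real.sqrt_eq_rpow, ← Real.rpow_add ht]
      congr 1
      push_cast
      ring
    rw [h2]
    calc _ = 24 * Real.exp 4 * √2 * t ^ (((l : ℝ) - α) / 2) := by field_simp
      _ ≤ 24 * Real.exp 4 * √2 * (4 ^ |((l : ℝ) - α) / 2| * s ^ (((l : ℝ) - α) / 2)) := by gcongr
      _ = _ := by rw [hD]; ring
  have hmeas := measurable_gradNorm (l := l) (α := α) hp hf
  have hbound : ∀ t : ℝ, 0 < t → gradNorm (l + 1) α p f t ≤ ENNReal.ofReal (4 * D) *
      ∫⁻ s, ratioKernel 1 √t √s * gradNorm l α p f s ∂dtOverT := by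
    intro t ht
    rw [lintegral_dtOverT (fun s => ratioKernel 1 √t √s * gradNorm l α p f s)
      (((measurable_ratioKernel 1).comp (measurable_const.prodMk
        Real.continuous_sqrt.measurable)).mul hmeas)]
    have hsub : Icc (t / 4) (t / 2) ⊆ Ioi 0 := fun s hs => by
      have := hs.1
      exact mem_Ioi.2 (by linarith)
    -- The pointwise bound is averaged over s in [t/4, t/2], an interval of length t/4, to turn it
    -- into an integral against ds/s.
    calc gradNorm (l + 1) α p f t
        = ENNReal.ofReal 4 * (ENNReal.ofReal (1 / t) * gradNorm (l + 1) α p f t *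
            ENNReal.ofReal (t / 2 - t / 4)) := by
          rw [mul_right_comm, ← ENNReal.ofReal_mul (by positivity), ← mul_assoc,
            ← ENNReal.ofReal_mul (by norm_num), show 4 * (1 / t * (t / 2 - t / 4)) = 1 by
              field_simp; norm_num]
          simp
      _ = ENNReal.ofReal 4 * ∫⁻ s in Icc (t / 4) (t / 2),
            ENNReal.ofReal (1 / t) * gradNorm (l + 1) α p f t := by
          rw [setLIntegral_const, Real.volume_Icc]
      _ ≤ ENNReal.ofReal 4 * ∫⁻ s in Icc (t / 4) (t / 2), ENNReal.ofReal D *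
            (ENNReal.ofReal (1 / s) * (ratioKernel 1 √t √s * gradNorm l α p f s)) := by
          refine mul_le_mul' le_rfl (setLIntegral_mono' measurableSet_Icc fun s hs => ?_)
          have hs0 : 0 < s := by linarith [hs.1]
          refine (mul_le_mul' le_rfl (hpt t s ht hs)).trans ?_
          rw [mul_left_comm, ← mul_assoc (ENNReal.ofReal (1 / s))]
          gcongr
          rw [ratioKernel_comm, ratioKernel_sqrt_of_le hs0 (by linarith [hs.2]),
            ← ENNReal.ofReal_mul (by positivity)]
          refine ENNReal.ofReal_le_ofReal ?_
          -- On this interval the kernel equals (s/t)^{1/2}, and s/t ≤ 1.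
          have h5 : s / t ≤ (s / t) ^ ((1 : ℝ) / 2) := by
            refine Real.self_le_rpow_of_le_one (by positivity) ?_ (by norm_num)
            rw [div_le_one ht]
            linarith [hs.2]
          calc 1 / t = 1 / s * (s / t) := by field_simp
            _ ≤ _ := by gcongr
      _ ≤ ENNReal.ofReal 4 * ∫⁻ s in Ioi 0, ENNReal.ofReal D *
            (ENNReal.ofReal (1 / s) * (ratioKernel 1 √t √s * gradNorm l α p f s)) := by
          gcongr
      _ = _ := by
          rw [lintegral_const_mul' _ _ ENNReal.ofReal_ne_top, ← mul_assoc,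
            ← ENNReal.ofReal_mul (by norm_num)]
  refine lt_of_le_of_lt (eLpNorm_le_mul_eLpNorm_of_ae_le_mul'' (c := ENNReal.ofReal (4 * D)) q
    (g := fun t => ∫⁻ s, ratioKernel 1 √t √s * gradNorm l α p f s ∂dtOverT) ?_ ?_) ?_
  · refine Measurable.aestronglyMeasurable ?_
    exact Measurable.lintegral_prod_right'
      (f := fun z : ℝ × ℝ => ratioKernel 1 √z.1 √z.2 * gradNorm l α p f z.2)
      (((measurable_ratioKernel 1).comp ((Real.continuous_sqrt.measurable.comp measurable_fst).prodMk
        (Real.continuous_sqrt.measurable.comp measurable_snd))).mul (hmeas.comp measurable_snd))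
  · filter_upwards [ae_dtOverT_pos] with t ht
    simpa only [enorm_eq_self] using hbound t ht
  · refine ENNReal.mul_lt_top ENNReal.ofReal_lt_top ?_
    exact (hschur q hq _ hmeas).trans_lt (ENNReal.mul_lt_top hC.lt_top h)

/-- A differentiable function tending to zero at infinity is bounded by the integral of its
derivative. -/
theorem enorm_le_lintegral_Ioi {v v' : ℝ → ℝ} (hv : ∀ s, HasDerivAt v (v' s) s)
    (hv' : Continuous v') (hlim : Filter.Tendsto v Filter.atTop (nhds 0)) (t : ℝ) :
    ‖v t‖ₑ ≤ ∫⁻ s in Ioi t, ‖v' s‖ₑ := by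
  have h1 : ∀ᶠ T in Filter.atTop, ‖v t - v T‖ₑ ≤ ∫⁻ s in Ioi t, ‖v' s‖ₑ := by
    filter_upwards [Filter.eventually_ge_atTop t] with T hT
    have h2 := intervalIntegral.integral_eq_sub_of_hasDerivAt (fun s _ => hv s)
      (hv'.intervalIntegrable t T)
    rw [← enorm_neg, neg_sub, ← h2, intervalIntegral.integral_of_le hT]
    refine (enorm_integral_le_lintegral_enorm _).trans ?_
    exact lintegral_mono_set Ioc_subset_Ioi_self
  have h3 : Filter.Tendsto (fun T => ‖v t - v T‖ₑ) Filter.atTop (nhds ‖v t - 0‖ₑ) :=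
    (continuous_enorm.tendsto _).comp (tendsto_const_nhds.sub hlim)
  rw [sub_zero] at h3
  exact le_of_tendsto h3 h1

/-- The seminorm with fewer differences is controlled by the one with more, for functions whose
heat extension decays. -/
theorem besovNorm_lt_top_of_add_two {f : ℤ → ℝ} (hf : ExpGrowth f) {l : ℕ} {α : ℝ} {p q : ℝ≥0∞}
    (hp : 1 ≤ p) (hq : 1 ≤ q) (hl : α < l)
    (hlim : ∀ n, Filter.Tendsto (fun t => heatSemigroup t (deltaRight^[l] f) n) Filter.atTop (nhds 0))
    (h : besovNorm (l + 2) α p q f < ∞) : besovNorm l α p q f < ∞ := by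
  obtain ⟨C, hC, hschur⟩ := logSize_sqrt.eLpNorm_le logSize_sqrt (sub_pos.2 hl)
  have hgl := hf.iterate_deltaRight l
  have hmeas := measurable_gradNorm (l := l + 2) (α := α) hp hf
  have hlap : ∀ s, eLpNorm (heatSemigroup s (laplacian (deltaRight^[l] f))) p Measure.count =
      eLpNorm (heatSemigroup s (deltaRight^[l + 2] f)) p (Measure.count : Measure ℤ) := fun s => by
    rw [laplacian_eq_deltaRight, heatSemigroup_translate', eLpNorm_translate,
      ← Function.iterate_add_apply, add_comm]
  have hbound : ∀ t : ℝ, 0 < t → gradNorm l α p f t ≤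
      ∫⁻ s, ratioKernel (l - α) √t √s * gradNorm (l + 2) α p f s ∂dtOverT := by
    intro t ht
    rw [lintegral_dtOverT (fun s => ratioKernel (l - α) √t √s * gradNorm (l + 2) α p f s)
      (((measurable_ratioKernel _).comp (measurable_const.prodMk
        Real.continuous_sqrt.measurable)).mul hmeas)]
    calc gradNorm l α p f t
        ≤ ENNReal.ofReal (t ^ ((l - α) / 2)) * eLpNorm (fun n => ∫⁻ s in Ioi t,
            ‖heatSemigroup s (laplacian (deltaRight^[l] f)) n‖ₑ) p Measure.count := by
          rw [gradNorm]
          refine mul_le_mul' le_rfl (eLpNorm_mono_enorm fun n => ?_)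
          rw [enorm_eq_self]
          exact enorm_le_lintegral_Ioi (fun s => hgl.hasDerivAt_heatSemigroup s n)
            (hgl.laplacian.continuous_heatSemigroup n) (hlim n) t
      _ ≤ ENNReal.ofReal (t ^ ((l - α) / 2)) * ∫⁻ s in Ioi t,
            eLpNorm (heatSemigroup s (deltaRight^[l + 2] f)) p (Measure.count : Measure ℤ) := by
          refine mul_le_mul' le_rfl ((eLpNorm_count_lintegral_le hp
            (F := fun s n => ‖heatSemigroup s (laplacian (deltaRight^[l] f)) n‖ₑ)
            (fun n => (hgl.laplacian.continuous_heatSemigroup n).enorm.measurable)).trans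
              (le_of_eq ?_))
          refine lintegral_congr fun s => ?_
          rw [eLpNorm_enorm, hlap]
      _ = ∫⁻ s in Ioi t, ENNReal.ofReal (t ^ ((l - α) / 2)) *
            eLpNorm (heatSemigroup s (deltaRight^[l + 2] f)) p (Measure.count : Measure ℤ) := by
          rw [lintegral_const_mul' _ _ ENNReal.ofReal_ne_top]
      _ = ∫⁻ s in Ioi t, ENNReal.ofReal (1 / s) *
            (ratioKernel (l - α) √t √s * gradNorm (l + 2) α p f s) := by
          -- An exact identity: the two extra differences give one extra power of s, cancelled by
          -- 1/s, and the remaining (t/s)^{(l-α)/2} is the Hardy kernel in √t and √s.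
          refine setLIntegral_congr_fun measurableSet_Ioi fun s hs => ?_
          have hts : t < s := hs
          have hs0 : 0 < s := ht.trans hts
          rw [ratioKernel_sqrt_of_le ht hts.le, gradNorm, ← mul_assoc, ← mul_assoc,
            ← ENNReal.ofReal_mul (by positivity), ← ENNReal.ofReal_mul (by positivity)]
          congr 2
          have h2 : s ^ (((l + 2 : ℕ) - α) / 2) = s ^ (((l : ℝ) - α) / 2) * s := by
            nth_rewrite 3 [← Real.rpow_one s]
            rw [← Real.rpow_add hs0]
            congr 1
            push_cast
            ring
          rw [h2, Real.div_rpow ht.le hs0.le]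
          have := Real.rpow_pos_of_pos hs0 (((l : ℝ) - α) / 2)
          field_simp
      _ ≤ _ := lintegral_mono_set (Ioi_subset_Ioi ht.le)
  refine lt_of_le_of_lt (eLpNorm_mono_enorm_ae ?_) ((hschur q hq _ hmeas).trans_lt
    (ENNReal.mul_lt_top hC.lt_top h))
  filter_upwards [ae_dtOverT_pos] with t ht
  simpa only [enorm_eq_self] using hbound t ht

/-! ### The growth condition and its consequences -/

/-- The weighted function `(1+|n|)^{-α} |f n|`. -/
noncomputable def growthFun (α : ℝ) (f : ℤ → ℝ) (n : ℤ) : ℝ≥0∞ :=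
  ENNReal.ofReal ((1 + |(n : ℝ)|) ^ (-α)) * ‖f n‖ₑ

theorem ae_weightMeasure_iff {P : ℤ → Prop} : (∀ᵐ n ∂weightMeasure, P n) ↔ ∀ n, P n := by
  rw [weightMeasure, Measure.ae_sum_iff]
  refine forall_congr' fun n => ?_
  rw [Measure.ae_ennreal_smul_measure_iff, ae_dirac_iff (MeasurableSet.of_discrete)]
  rw [Ne, ENNReal.ofReal_eq_zero, not_le]
  positivity

/-- Every point of ℤ has positive mass, so almost everywhere means everywhere. -/
theorem lt_top_of_eLpNorm_weightMeasure {q : ℝ≥0∞} (hq : 1 ≤ q) {g : ℤ → ℝ≥0∞}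
    (h : eLpNorm g q weightMeasure < ∞) (n : ℤ) : g n < ∞ := by
  rcases eq_or_ne q ∞ with rfl | hq'
  · have h1 := ae_weightMeasure_iff.1 (enorm_ae_le_eLpNormEssSup g weightMeasure) n
    rw [enorm_eq_self] at h1
    rw [eLpNorm_exponent_top] at h
    exact h1.trans_lt h
  · have hq0 : q ≠ 0 := (zero_lt_one.trans_le hq).ne'
    have h1 := (eLpNorm_lt_top_iff_lintegral_rpow_enorm_lt_top hq0 hq').1 h
    have h2 := ae_weightMeasure_iff.1 (ae_lt_top measurable_from_top h1.ne) n
    rw [enorm_eq_self] at h2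
    exact (ENNReal.rpow_lt_top_iff_of_pos (ENNReal.toReal_pos hq0 hq')).1 h2

theorem rpow_abs_bounds {α : ℝ} (hα : 0 ≤ α) (n : ℤ) :
    1 + |(n : ℝ)| ^ α ≤ 2 * (1 + |(n : ℝ)|) ^ α ∧
      (1 + |(n : ℝ)|) ^ α ≤ 2 ^ α * (1 + |(n : ℝ)| ^ α) := by
  have h0 : 0 ≤ |(n : ℝ)| := abs_nonneg _
  constructor
  · have h1 : (1 : ℝ) ≤ (1 + |(n : ℝ)|) ^ α := Real.one_le_rpow (by linarith) hα
    have h2 : |(n : ℝ)| ^ α ≤ (1 + |(n : ℝ)|) ^ α := by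
      gcongr
      linarith
    linarith
  · have h4 : 0 ≤ |(n : ℝ)| ^ α := by positivity
    rcases le_total |(n : ℝ)| 1 with h | h
    · calc (1 + |(n : ℝ)|) ^ α ≤ 2 ^ α := by gcongr; linarith
        _ ≤ 2 ^ α * (1 + |(n : ℝ)| ^ α) := le_mul_of_one_le_right (by positivity) (by linarith)
    · calc (1 + |(n : ℝ)|) ^ α ≤ (2 * |(n : ℝ)|) ^ α := by gcongr; linarith
        _ = 2 ^ α * |(n : ℝ)| ^ α := Real.mul_rpow zero_le_two h0
        _ ≤ _ := by gcongr; linarith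

theorem memLp_iff_growthFun {α : ℝ} (hα : 0 ≤ α) {q : ℝ≥0∞} {f : ℤ → ℝ} :
    MemLp (fun n : ℤ => f n / (1 + |(n : ℝ)| ^ α)) q weightMeasure ↔
      eLpNorm (growthFun α f) q weightMeasure < ∞ := by
  have hmeas : ∀ {E : Type} [TopologicalSpace E] (g : ℤ → E), AEStronglyMeasurable g weightMeasure :=
    fun g => (StronglyMeasurable.of_discrete).aestronglyMeasurable
  have hn : ∀ n : ℤ, ‖f n / (1 + |(n : ℝ)| ^ α)‖ₑ =
      ENNReal.ofReal ((1 + |(n : ℝ)| ^ α)⁻¹) * ‖f n‖ₑ := fun n => by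
    rw [div_eq_mul_inv, enorm_mul, mul_comm, Real.enorm_of_nonneg (by positivity)]
  constructor
  · intro h
    refine lt_of_le_of_lt (eLpNorm_le_mul_eLpNorm_of_ae_le_mul'' (c := ENNReal.ofReal 2) q
      (hmeas _) (Filter.Eventually.of_forall fun n => ?_)) (ENNReal.mul_lt_top (by simp) h.2)
    rw [hn, enorm_eq_self, growthFun, ← mul_assoc, ← ENNReal.ofReal_mul (by norm_num)]
    gcongr ENNReal.ofReal ?_ * _
    rw [Real.rpow_neg (by positivity), ← div_eq_mul_inv, inv_le_comm₀ (by positivity)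
      (by positivity), inv_div, div_le_iff₀ (by norm_num), mul_comm]
    exact (rpow_abs_bounds hα n).1
  · intro h
    refine ⟨hmeas _, lt_of_le_of_lt (eLpNorm_le_mul_eLpNorm_of_ae_le_mul''
      (c := ENNReal.ofReal (2 ^ α)) q (g := growthFun α f)
      (hmeas _) (Filter.Eventually.of_forall fun n => ?_)) (ENNReal.mul_lt_top (by simp) h)⟩
    rw [hn, enorm_eq_self, growthFun, ← mul_assoc, ← ENNReal.ofReal_mul (by positivity)]
    gcongr ENNReal.ofReal ?_ * _
    rw [Real.rpow_neg (by positivity), ← div_eq_mul_inv, inv_le_comm₀ (by positivity)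
      (by positivity), inv_div, div_le_iff₀ (by positivity), mul_comm]
    exact (rpow_abs_bounds hα n).2

theorem exists_rpow_le_exp (c : ℝ) : ∃ C : ℝ, 0 < C ∧ ∀ r : ℝ, 0 ≤ r →
    (1 + r) ^ c ≤ C * Real.exp r := by
  obtain ⟨N, hN⟩ := exists_nat_ge c
  refine ⟨N.factorial * Real.exp 1, by positivity, fun r hr => ?_⟩
  calc (1 + r) ^ c ≤ (1 + r) ^ (N : ℝ) := Real.rpow_le_rpow_of_exponent_le (by linarith) hN
    _ = (1 + r) ^ N := Real.rpow_natCast _ _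
    _ ≤ N.factorial * Real.exp (1 + r) := by
      have := Real.pow_div_factorial_le_exp (1 + r) (by linarith) N
      rwa [div_le_iff₀' (by positivity)] at this
    _ = _ := by rw [Real.exp_add, mul_assoc]

/-- Exponential decay in |j|/x beats every power of (1+|j|)/x, and recentring from n to 0 costs
e^{|n|/x}. The bound x ≥ 1 absorbs the 1 in 1+|j|. -/
theorem exists_exp_neg_le {M : ℝ} (hM : 0 ≤ M) : ∃ C : ℝ, 0 < C ∧ ∀ x : ℝ, 1 ≤ x → ∀ n j : ℤ,
    Real.exp (-(|(n : ℝ) - j| / x)) ≤ C * Real.exp (|(n : ℝ)| / x) * (x / (1 + |(j : ℝ)|)) ^ M := by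
  obtain ⟨C, hC, h⟩ := exists_rpow_le_exp M
  refine ⟨C, hC, fun x hx n j => ?_⟩
  have hx0 : 0 < x := by linarith
  have hj : 0 ≤ |(j : ℝ)| := abs_nonneg _
  have h1 := h (|(j : ℝ)| / x) (by positivity)
  have h2 : ((1 + |(j : ℝ)|) / x) ^ M ≤ (1 + |(j : ℝ)| / x) ^ M := by
    gcongr
    rw [add_div]
    gcongr
    exact (div_le_one hx0).2 hx
  have h3 : (x / (1 + |(j : ℝ)|)) ^ M * ((1 + |(j : ℝ)|) / x) ^ M = 1 := by
    rw [← Real.mul_rpow (by positivity) (by positivity), div_mul_div_comm,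
      mul_comm x, div_self (by positivity), Real.one_rpow]
  have h4 : |(j : ℝ)| - |(n : ℝ)| ≤ |(n : ℝ) - j| := by
    rw [abs_sub_comm]
    exact abs_sub_abs_le_abs_sub _ _
  calc Real.exp (-(|(n : ℝ) - j| / x)) ≤ Real.exp (|(n : ℝ)| / x + -(|(j : ℝ)| / x)) := by
        refine Real.exp_le_exp.2 ?_
        rw [← neg_div, ← neg_div, ← add_div]
        gcongr
        linarith
    _ = Real.exp (|(n : ℝ)| / x) * Real.exp (-(|(j : ℝ)| / x)) *
          ((x / (1 + |(j : ℝ)|)) ^ M * ((1 + |(j : ℝ)|) / x) ^ M) := by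
        rw [h3, Real.exp_add, mul_one]
    _ ≤ Real.exp (|(n : ℝ)| / x) * Real.exp (-(|(j : ℝ)| / x)) *
          ((x / (1 + |(j : ℝ)|)) ^ M * (C * Real.exp (|(j : ℝ)| / x))) := by
        gcongr
        exact h2.trans h1
    _ = _ := by
        have h5 : Real.exp (-(|(j : ℝ)| / x)) * Real.exp (|(j : ℝ)| / x) = 1 := by
          rw [← Real.exp_add]
          simp
        linear_combination (Real.exp (|(n : ℝ)| / x) * C * (x / (1 + |(j : ℝ)|)) ^ M) * h5

section Growth

variable {α : ℝ} {q : ℝ≥0∞} {f : ℤ → ℝ}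

/-- Weighted `ℓ^q` bounds imply weighted summability, with an arbitrarily small loss. -/
theorem tsum_weight_lt_top (hq : 1 ≤ q) (h : eLpNorm (growthFun α f) q weightMeasure < ∞)
    {ε : ℝ} (hε : 0 < ε) :
    ∑' j : ℤ, ENNReal.ofReal ((1 + |(j : ℝ)|) ^ (-(α + 1 + ε))) * ‖f j‖ₑ < ∞ := by
  obtain ⟨C, hC, hschur⟩ := logSize_int.eLpNorm_le logSize_int hε
  -- The Schur bound is read off at n = 0, where the kernel is (1+|j|)^{-ε}; the density of μ
  -- supplies the remaining (1+|j|)^{-1}.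
  have h1 := lt_top_of_eLpNorm_weightMeasure hq ((hschur q hq (growthFun α f)
    measurable_from_top).trans_lt (ENNReal.mul_lt_top hC.lt_top h)) 0
  rw [lintegral_weightMeasure] at h1
  refine lt_of_le_of_lt (le_of_eq (tsum_congr fun j => ?_)) h1
  have hj : 0 < 1 + |(j : ℝ)| := by positivity
  rw [ratioKernel_of_le (by simp) (by simp), growthFun, ← mul_assoc, ← mul_assoc,
    ← ENNReal.ofReal_mul (by positivity), ← ENNReal.ofReal_mul (by positivity)]
  congr 2
  simp only [Int.cast_zero, abs_zero, add_zero]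
  rw [Real.div_rpow zero_le_one hj.le, Real.one_rpow, one_div, one_div, ← Real.rpow_neg hj.le,
    ← Real.rpow_neg_one, ← Real.rpow_add hj, ← Real.rpow_add hj]
  congr 1
  ring

theorem expGrowth_of_growthFun (hq : 1 ≤ q) (h : eLpNorm (growthFun α f) q weightMeasure < ∞) :
    ExpGrowth f := by
  have h1 := tsum_weight_lt_top hq h one_pos
  set S := ∑' j : ℤ, ENNReal.ofReal ((1 + |(j : ℝ)|) ^ (-(α + 1 + 1))) * ‖f j‖ₑ with hS
  obtain ⟨C, hC, hexp⟩ := exists_rpow_le_exp (α + 1 + 1)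
  refine ⟨S.toReal * C, fun j => ?_⟩
  have hj : 0 < 1 + |(j : ℝ)| := by positivity
  have h2 : ENNReal.ofReal ((1 + |(j : ℝ)|) ^ (-(α + 1 + 1))) * ‖f j‖ₑ ≤ S := ENNReal.le_tsum j
  rw [Real.enorm_eq_ofReal_abs, ← ENNReal.ofReal_mul (by positivity)] at h2
  have h3 := (ENNReal.ofReal_le_iff_le_toReal h1.ne).1 h2
  rw [Real.rpow_neg hj.le, inv_mul_le_iff₀ (by positivity)] at h3
  calc |f j| ≤ (1 + |(j : ℝ)|) ^ (α + 1 + 1) * S.toReal := h3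
    _ ≤ (C * Real.exp |(j : ℝ)|) * S.toReal := by
      gcongr
      exact hexp _ (abs_nonneg _)
    _ = _ := by ring

/-- Decay of the differences of the heat extension for large times. -/
theorem tendsto_heatSemigroup_iterate_deltaRight (hα : 0 ≤ α) (hq : 1 ≤ q)
    (h : eLpNorm (growthFun α f) q weightMeasure < ∞) {l : ℕ} (hl : α < l) (n : ℤ) :
    Filter.Tendsto (fun t => heatSemigroup t (deltaRight^[l] f) n) Filter.atTop (nhds 0) := by
  have hf := expGrowth_of_growthFun hq h
  -- With this ε the powers of √t add up to (α + 1 + ε) - (l + 1) = -ε.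
  set ε : ℝ := ((l : ℝ) - α) / 2 with hε
  have hε0 : 0 < ε := by rw [hε]; linarith
  have hS := tsum_weight_lt_top hq h hε0
  set S := ∑' j : ℤ, ENNReal.ofReal ((1 + |(j : ℝ)|) ^ (-(α + 1 + ε))) * ‖f j‖ₑ with hSdef
  obtain ⟨C, hC, hK⟩ := exists_enorm_heatSemigroup_iterate_deltaRight_le l
  obtain ⟨D, hD, hE⟩ := exists_exp_neg_le (M := α + 1 + ε) (by linarith)
  have hbound : ∀ t : ℝ, 1 ≤ t → ‖heatSemigroup t (deltaRight^[l] f) n‖ ≤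
      C * D * Real.exp |(n : ℝ)| * S.toReal * √t ^ (-ε) := by
    intro t ht
    have hs : 1 ≤ √t := Real.one_le_sqrt.2 ht
    have hs0 : 0 < √t := by linarith
    have h1 : ‖heatSemigroup t (deltaRight^[l] f) n‖ₑ ≤
        ENNReal.ofReal (C * D * Real.exp |(n : ℝ)| * √t ^ (-ε)) * S := by
      refine (hK f hf t ht n).trans ?_
      rw [hSdef, ← ENNReal.tsum_mul_left, ← ENNReal.tsum_mul_left]
      refine ENNReal.tsum_le_tsum fun j => ?_
      have hj : 0 < 1 + |(j : ℝ)| := by positivity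
      rw [← mul_assoc, ← mul_assoc, ← ENNReal.ofReal_mul (by positivity),
        ← ENNReal.ofReal_mul (by positivity)]
      gcongr ENNReal.ofReal ?_ * _
      have h2 : Real.exp (|(n : ℝ)| / √t) ≤ Real.exp |(n : ℝ)| :=
        Real.exp_le_exp.2 (div_le_self (abs_nonneg _) hs)
      calc C / √t ^ (l + 1) * Real.exp (-(|(n : ℝ) - j| / √t))
          ≤ C / √t ^ (l + 1) * (D * Real.exp |(n : ℝ)| * (√t / (1 + |(j : ℝ)|)) ^ (α + 1 + ε)) := by
            gcongr
            exact (hE _ hs n j).trans (by gcongr)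
        _ = _ := by
            rw [Real.div_rpow hs0.le hj.le, Real.rpow_neg hj.le,
              show α + 1 + ε = -ε + ((l + 1 : ℕ) : ℝ) by rw [hε]; push_cast; ring,
              Real.rpow_add hs0, Real.rpow_natCast]
            field_simp
    rw [← ofReal_norm, ← ENNReal.ofReal_toReal hS.ne,
      ← ENNReal.ofReal_mul (by positivity)] at h1
    refine ((ENNReal.ofReal_le_ofReal_iff (by positivity)).1 h1).trans (le_of_eq (by ring))
  refine squeeze_zero_norm' ((Filter.eventually_ge_atTop 1).mono hbound) ?_
  have h3 : Filter.Tendsto (fun t : ℝ => √t ^ (-ε)) Filter.atTop (nhds 0) :=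
    (tendsto_rpow_neg_atTop hε0).comp Real.tendsto_sqrt_atTop
  simpa using h3.const_mul (C * D * Real.exp |(n : ℝ)| * S.toReal)

theorem enorm_nat_le_sum (f : ℤ → ℝ) (N : ℕ) :
    ‖f N‖ₑ ≤ ‖f 0‖ₑ + ∑ j ∈ Finset.range N, ‖deltaRight f j‖ₑ := by
  induction N with
  | zero => simp
  | succ N ih =>
    rw [Finset.sum_range_succ, ← add_assoc]
    have : f ((N + 1 : ℕ) : ℤ) = f N - deltaRight f N := by simp [deltaRight]
    rw [this]
    exact (enorm_sub_le).trans (add_le_add ih le_rfl)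

theorem enorm_neg_nat_le_sum (f : ℤ → ℝ) (N : ℕ) :
    ‖f (-(N : ℤ))‖ₑ ≤ ‖f 0‖ₑ + ∑ j ∈ Finset.range N, ‖deltaRight f (-((j : ℤ) + 1))‖ₑ := by
  induction N with
  | zero => simp
  | succ N ih =>
    rw [Finset.sum_range_succ, ← add_assoc]
    have : f (-((N + 1 : ℕ) : ℤ)) = f (-(N : ℤ)) + deltaRight f (-((N : ℤ) + 1)) := by
      simp [deltaRight]
    rw [this]
    exact (enorm_add_le _ _).trans (add_le_add ih le_rfl)

/-- f(n) is f(0) plus a sum of differences between 0 and n. Each difference, multiplied by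
(1+|n|)^{-α}, is exactly a term of the Hardy integral with exponent α; f(0) enters as a mass at the
origin. -/
theorem growthFun_le (α : ℝ) (f : ℤ → ℝ) (n : ℤ) :
    growthFun α f n ≤ ∫⁻ j, ratioKernel α (1 + |(n : ℝ)|) (1 + |(j : ℝ)|) *
      (growthFun (α - 1) (deltaRight f) j + ({0} : Set ℤ).indicator (fun _ => ‖f 0‖ₑ) j)
        ∂weightMeasure := by
  set x : ℝ := 1 + |(n : ℝ)| with hx
  have hx0 : 1 ≤ x := by simp [hx]
  have hterm : ∀ j : ℤ, |j| ≤ |n| → ENNReal.ofReal (x ^ (-α)) * ‖deltaRight f j‖ₑ =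
      ENNReal.ofReal (1 / (1 + |(j : ℝ)|)) * (ratioKernel α x (1 + |(j : ℝ)|) *
        growthFun (α - 1) (deltaRight f) j) := by
    intro j hj
    have hj0 : 0 < 1 + |(j : ℝ)| := by positivity
    have hjx : 1 + |(j : ℝ)| ≤ x := by
      rw [hx]
      have : |(j : ℝ)| ≤ |(n : ℝ)| := by exact_mod_cast hj
      linarith
    rw [ratioKernel_comm, ratioKernel_of_le hj0 hjx, growthFun, ← mul_assoc, ← mul_assoc,
      ← ENNReal.ofReal_mul (by positivity), ← ENNReal.ofReal_mul (by positivity)]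
    congr 2
    rw [Real.div_rpow hj0.le (by linarith), show -(α - 1) = 1 + -α by ring, Real.rpow_add hj0,
      Real.rpow_one, Real.rpow_neg hj0.le, Real.rpow_neg (by linarith)]
    have := Real.rpow_pos_of_pos hj0 α
    field_simp
  have hzero : ENNReal.ofReal (x ^ (-α)) * ‖f 0‖ₑ ≤
      ∑' j : ℤ, ENNReal.ofReal (1 / (1 + |(j : ℝ)|)) * (ratioKernel α x (1 + |(j : ℝ)|) *
        ({0} : Set ℤ).indicator (fun _ => ‖f 0‖ₑ) j) := by
    refine le_trans (le_of_eq ?_) (ENNReal.le_tsum 0)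
    have : ratioKernel α x 1 = ENNReal.ofReal (x ^ (-α)) := by
      rw [ratioKernel_comm, ratioKernel_of_le one_pos hx0, Real.rpow_neg (by linarith), one_div,
        Real.inv_rpow (by linarith)]
    simp [this]
  have hsum : ENNReal.ofReal (x ^ (-α)) * ‖f n‖ₑ ≤ ENNReal.ofReal (x ^ (-α)) * ‖f 0‖ₑ +
      ∑' j : ℤ, ENNReal.ofReal (1 / (1 + |(j : ℝ)|)) * (ratioKernel α x (1 + |(j : ℝ)|) *
        growthFun (α - 1) (deltaRight f) j) := by
    set H : ℤ → ℝ≥0∞ := fun j => ENNReal.ofReal (1 / (1 + |(j : ℝ)|)) *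
      (ratioKernel α x (1 + |(j : ℝ)|) * growthFun (α - 1) (deltaRight f) j) with hH
    rcases Int.eq_nat_or_neg n with ⟨N, hN | hN⟩
    · have hinj : Function.Injective fun j : ℕ => (j : ℤ) := Nat.cast_injective
      calc ENNReal.ofReal (x ^ (-α)) * ‖f n‖ₑ
          ≤ ENNReal.ofReal (x ^ (-α)) * (‖f 0‖ₑ + ∑ j ∈ Finset.range N, ‖deltaRight f j‖ₑ) := by
            gcongr
            rw [hN]
            exact enorm_nat_le_sum f N
        _ = ENNReal.ofReal (x ^ (-α)) * ‖f 0‖ₑ + ∑ j ∈ Finset.range N, H j := by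
            rw [mul_add, Finset.mul_sum]
            congr 1
            refine Finset.sum_congr rfl fun j hj => hterm j ?_
            have := Finset.mem_range.1 hj
            rw [hN, abs_of_nonneg (by omega), abs_of_nonneg (by omega)]
            omega
        _ ≤ _ := by
            gcongr
            exact (ENNReal.sum_le_tsum _).trans (ENNReal.tsum_comp_le_tsum_of_injective hinj H)
    · have hinj : Function.Injective fun j : ℕ => -((j : ℤ) + 1) := fun i j h => by
        simpa using h
      calc ENNReal.ofReal (x ^ (-α)) * ‖f n‖ₑ
          ≤ ENNReal.ofReal (x ^ (-α)) *
              (‖f 0‖ₑ + ∑ j ∈ Finset.range N, ‖deltaRight f (-((j : ℤ) + 1))‖ₑ) := by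
            gcongr
            rw [hN]
            exact enorm_neg_nat_le_sum f N
        _ = ENNReal.ofReal (x ^ (-α)) * ‖f 0‖ₑ + ∑ j ∈ Finset.range N, H (-((j : ℤ) + 1)) := by
            rw [mul_add, Finset.mul_sum]
            congr 1
            refine Finset.sum_congr rfl fun j hj => hterm _ ?_
            have := Finset.mem_range.1 hj
            rw [hN, abs_neg, abs_neg, abs_of_nonneg (by omega), abs_of_nonneg (by omega)]
            omega
        _ ≤ _ := by
            gcongr
            exact (ENNReal.sum_le_tsum _).trans (ENNReal.tsum_comp_le_tsum_of_injective hinj H)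
  rw [growthFun, lintegral_weightMeasure]
  simp only [mul_add]
  rw [ENNReal.tsum_add, add_comm (∑' _, _)]
  exact hsum.trans (add_le_add hzero le_rfl)

/-- The growth condition for `δ_right f` implies that for `f`. -/
theorem eLpNorm_growthFun_of_deltaRight (hα : 0 < α) (hq : 1 ≤ q)
    (h : eLpNorm (growthFun (α - 1) (deltaRight f)) q weightMeasure < ∞) :
    eLpNorm (growthFun α f) q weightMeasure < ∞ := by
  obtain ⟨C, hC, hschur⟩ := logSize_int.eLpNorm_le logSize_int hα
  have hmeas : ∀ g : ℤ → ℝ≥0∞, AEStronglyMeasurable g weightMeasure :=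
    fun g => (StronglyMeasurable.of_discrete).aestronglyMeasurable
  refine lt_of_le_of_lt (eLpNorm_mono_enorm fun n => ?_) ((hschur q hq (fun j =>
    growthFun (α - 1) (deltaRight f) j + ({0} : Set ℤ).indicator (fun _ => ‖f 0‖ₑ) j)
      measurable_from_top).trans_lt (ENNReal.mul_lt_top hC.lt_top ?_))
  · rw [enorm_eq_self, enorm_eq_self]
    exact growthFun_le α f n
  · refine (eLpNorm_add_le (hmeas _) (hmeas _) hq).trans_lt (ENNReal.add_lt_top.2 ⟨h, ?_⟩)
    refine (eLpNorm_indicator_const_le _ _).trans_lt (ENNReal.mul_lt_top (by simp) ?_)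
    refine ENNReal.rpow_lt_top_of_nonneg (by positivity) ?_
    have h1 : weightMeasure {(0 : ℤ)} = 1 := by
      rw [← lintegral_indicator_one (MeasurableSet.of_discrete), lintegral_weightMeasure,
        tsum_eq_single 0 fun j hj => by simp [hj]]
      simp
    simp [h1]

end Growth

/-! ### Taylor expansion in time and the growth of `δ_right f` -/

/-- The derivative of a Taylor polynomial with respect to its base point. -/
theorem hasDerivAt_taylor_base {u : ℕ → ℝ → ℝ} (hu : ∀ m s, HasDerivAt (u m) (u (m + 1) s) s)
    (k : ℕ) (s : ℝ) :
    HasDerivAt (fun s => ∑ m ∈ Finset.range (k + 1), (-s) ^ m / m.factorial * u m s)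
      ((-s) ^ k / k.factorial * u (k + 1) s) s := by
  induction k with
  | zero => simpa using hu 0 s
  | succ k ih =>
    simp_rw [Finset.sum_range_succ _ (k + 1)]
    have h1 : HasDerivAt (fun s : ℝ => (-s) ^ (k + 1)) (((k + 1 : ℕ) : ℝ) * (-s) ^ k * (-1)) s := by
      simpa using (hasDerivAt_neg s).fun_pow (k + 1)
    refine (ih.add ((h1.div_const _).mul (hu (k + 1) s))).congr_deriv ?_
    rw [Nat.factorial_succ]
    push_cast
    field_simp
    ring

/-- The Taylor polynomial with base point s, evaluated at 0, has a derivative in s that telescopes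
to one term. Integrating it over [0, t] gives the remainder; the factorials are bounded below by 1.
-/
theorem enorm_zero_le_taylor {u : ℕ → ℝ → ℝ} (hu : ∀ m s, HasDerivAt (u m) (u (m + 1) s) s)
    (k : ℕ) {t : ℝ} (ht : 0 ≤ t) :
    ‖u 0 0‖ₑ ≤ (∑ m ∈ Finset.range (k + 1), ENNReal.ofReal (t ^ m) * ‖u m t‖ₑ) +
      ∫⁻ s in Ioc 0 t, ENNReal.ofReal (s ^ k) * ‖u (k + 1) s‖ₑ := by
  have hcont : ∀ m, Continuous (u m) := fun m =>
    continuous_iff_continuousAt.2 fun s => (hu m s).continuousAt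
  set φ : ℝ → ℝ := fun s => ∑ m ∈ Finset.range (k + 1), (-s) ^ m / m.factorial * u m s with hφ
  have hφ0 : φ 0 = u 0 0 := by
    rw [hφ]
    simp only
    rw [Finset.sum_range_succ', Finset.sum_eq_zero fun m _ => by simp]
    simp
  have hfac : ∀ m : ℕ, ∀ s : ℝ, 0 ≤ s → ‖(-s) ^ m / (m.factorial : ℝ)‖ₑ ≤ ENNReal.ofReal (s ^ m) := by
    intro m s hs
    rw [Real.enorm_eq_ofReal_abs, abs_div, abs_pow, abs_neg, abs_of_nonneg hs, Nat.abs_cast]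
    refine ENNReal.ofReal_le_ofReal (div_le_self (by positivity) ?_)
    exact_mod_cast m.factorial_pos
  have hint := intervalIntegral.integral_eq_sub_of_hasDerivAt
    (fun s (_ : s ∈ uIcc 0 t) => hasDerivAt_taylor_base hu k s)
    (Continuous.intervalIntegrable (by have := hcont (k + 1); fun_prop) 0 t)
  have h0 : u 0 0 = φ t - ∫ s in (0 : ℝ)..t, (-s) ^ k / k.factorial * u (k + 1) s := by
    rw [hint, ← hφ0]
    ring
  rw [h0]
  refine enorm_sub_le.trans (add_le_add ?_ ?_)
  · refine (enorm_sum_le _ _).trans (Finset.sum_le_sum fun m _ => ?_)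
    rw [enorm_mul]
    gcongr
    exact hfac m t ht
  · rw [intervalIntegral.integral_of_le ht]
    refine (enorm_integral_le_lintegral_enorm _).trans ?_
    refine setLIntegral_mono' measurableSet_Ioc fun s hs => ?_
    rw [enorm_mul]
    gcongr
    exact hfac k s hs.1.le

theorem iterate_laplacian_deltaRight (m : ℕ) (f : ℤ → ℝ) :
    laplacian^[m] (deltaRight f) = translate (-m) (deltaRight^[2 * m + 1] f) := by
  rw [iterate_laplacian_eq, Function.iterate_succ_apply]

theorem ratioKernel_one_ge {x y e : ℝ} (h1 : e ≤ x / y) (h2 : e ≤ y / x) :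
    ENNReal.ofReal e ≤ ratioKernel 1 x y := by
  rw [ratioKernel, Real.rpow_one]
  exact ENNReal.ofReal_le_ofReal (le_min h1 h2)

/-- The terms of the Taylor polynomial at time `(1+|n|)²`. -/
theorem exists_taylor_term_le {α : ℝ} (hα : 0 ≤ α) (m : ℕ) : ∃ C : ℝ≥0∞, C ≠ ∞ ∧
    ∀ f : ℤ → ℝ, ExpGrowth f → ∀ n : ℤ,
      ENNReal.ofReal ((1 + |(n : ℝ)|) ^ (-(α - 1))) * (ENNReal.ofReal (((1 + |(n : ℝ)|) ^ 2) ^ m) *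
        ‖heatSemigroup ((1 + |(n : ℝ)|) ^ 2) (laplacian^[m] (deltaRight f)) n‖ₑ) ≤
      C * ∫⁻ j, ratioKernel 1 (1 + |(n : ℝ)|) (1 + |(j : ℝ)|) * growthFun α f j ∂weightMeasure := by
  obtain ⟨C, hC, hK⟩ := exists_enorm_heatSemigroup_iterate_deltaRight_le (2 * m + 1)
  -- Two decay exponents are needed: after multiplication by (y/x)^{α+1}, exponent α leaves y/x and
  -- exponent α + 2 leaves x/y, the two sides of the minimum in the kernel.
  obtain ⟨D, hD, hE⟩ := exists_exp_neg_le hα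
  obtain ⟨D', hD', hE'⟩ := exists_exp_neg_le (M := α + 2) (by linarith)
  set B : ℝ := max D D' * Real.exp (m + 1) with hB
  have hB0 : 0 < B := by positivity
  refine ⟨ENNReal.ofReal (C * B), ENNReal.ofReal_ne_top, fun f hf n => ?_⟩
  set x : ℝ := 1 + |(n : ℝ)| with hx
  have hx1 : 1 ≤ x := by simp [hx]
  have hx0 : 0 < x := by linarith
  have hsq : √(x ^ 2) = x := Real.sqrt_sq hx0.le
  -- The point n - m accounts for the translation in Δ_d^m; with x = 1+|n| the resulting factor
  -- e^{|n-m|/x} is at most e^{m+1}.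
  have hker := hK f hf (x ^ 2) (one_le_pow₀ hx1) (n + -m)
  rw [hsq] at hker
  rw [iterate_laplacian_deltaRight, heatSemigroup_translate, lintegral_weightMeasure, ← mul_assoc,
    ← ENNReal.ofReal_mul (by positivity)]
  refine (mul_le_mul' le_rfl hker).trans ?_
  rw [← mul_assoc, ← ENNReal.ofReal_mul (by positivity), ← ENNReal.tsum_mul_left,
    ← ENNReal.tsum_mul_left]
  refine ENNReal.tsum_le_tsum fun j => ?_
  set y : ℝ := 1 + |(j : ℝ)| with hy
  have hy0 : 0 < y := by positivity
  set E : ℝ := Real.exp (-(|((n + -(m : ℤ) : ℤ) : ℝ) - j| / x)) with hEdef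
  have hnm : Real.exp (|((n + -(m : ℤ) : ℤ) : ℝ)| / x) ≤ Real.exp (m + 1) := by
    refine Real.exp_le_exp.2 ((div_le_iff₀ hx0).2 ?_)
    have h1 : |((n + -(m : ℤ) : ℤ) : ℝ)| ≤ |(n : ℝ)| + m := by
      push_cast
      exact (abs_add_le _ _).trans (by simp)
    have h2 : (m : ℝ) ≤ m * x := le_mul_of_one_le_right m.cast_nonneg hx1
    linarith
  have hgen : ∀ M D₀ : ℝ, 0 < D₀ → D₀ ≤ max D D' → E ≤ D₀ *
      Real.exp (|((n + -(m : ℤ) : ℤ) : ℝ)| / x) * (x / y) ^ M → E / B ≤ (x / y) ^ M := by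
    intro M D₀ hD0 hDm h
    rw [div_le_iff₀ hB0]
    calc E ≤ _ := h
      _ ≤ max D D' * Real.exp (m + 1) * (x / y) ^ M := by gcongr
      _ = _ := by rw [hB]; ring
  have he1 := hgen α D hD (le_max_left _ _) (hE x hx1 (n + -m) j)
  have he2 := hgen (α + 2) D' hD' (le_max_right _ _) (hE' x hx1 (n + -m) j)
  have hyx : (y / x) ^ (α + 1) * (x / y) ^ α = y / x := by
    rw [Real.rpow_add_one (by positivity), mul_right_comm, ← Real.mul_rpow (by positivity)
      (by positivity), div_mul_div_comm, mul_comm y, div_self (by positivity), Real.one_rpow, one_mul]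
  have hxy : (y / x) ^ (α + 1) * (x / y) ^ (α + 2) = x / y := by
    rw [show α + 2 = α + 1 + 1 by ring, Real.rpow_add_one (by positivity) (α + 1), ← mul_assoc,
      ← Real.mul_rpow (by positivity) (by positivity), div_mul_div_comm, mul_comm y,
      div_self (by positivity), Real.one_rpow, one_mul]
  have hkap : ENNReal.ofReal ((y / x) ^ (α + 1) * (E / B)) ≤ ratioKernel 1 x y := by
    refine ratioKernel_one_ge ?_ ?_
    · exact (mul_le_mul_of_nonneg_left he2 (by positivity)).trans hxy.le
    · exact (mul_le_mul_of_nonneg_left he1 (by positivity)).trans hyx.le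
  calc ENNReal.ofReal (x ^ (-(α - 1)) * (x ^ 2) ^ m * (C / x ^ (2 * m + 1 + 1))) *
        (ENNReal.ofReal E * ‖f j‖ₑ)
      = ENNReal.ofReal (C * B) * (ENNReal.ofReal (1 / y) *
          (ENNReal.ofReal ((y / x) ^ (α + 1) * (E / B)) * growthFun α f j)) := by
        rw [growthFun, ← hy]
        simp only [← mul_assoc]
        rw [← ENNReal.ofReal_mul (by positivity), ← ENNReal.ofReal_mul (by positivity),
          ← ENNReal.ofReal_mul (by positivity), ← ENNReal.ofReal_mul (by positivity)]
        congr 2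
        rw [Real.div_rpow hy0.le hx0.le, Real.rpow_add_one hy0.ne', Real.rpow_add_one hx0.ne',
          Real.rpow_neg hy0.le, show -(α - 1) = -α + 1 by ring, Real.rpow_add_one hx0.ne',
          Real.rpow_neg hx0.le]
        have := Real.rpow_pos_of_pos hy0 α
        have := Real.rpow_pos_of_pos hx0 α
        field_simp
        ring_nf
    _ ≤ _ := by gcongr

/-- A value at n is at most the ℓ^p norm. The powers of s and x then combine to (√s/x)^{α-1}, which
is the Hardy kernel between 1+|n| and √s because s ≤ (1+|n|)². -/
theorem remainder_le {α : ℝ} {p : ℝ≥0∞} (hp : 1 ≤ p) {f : ℤ → ℝ} (hf : ExpGrowth f)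
    (k : ℕ) (n : ℤ) :
    ENNReal.ofReal ((1 + |(n : ℝ)|) ^ (-(α - 1))) *
      ∫⁻ s in Ioc 0 ((1 + |(n : ℝ)|) ^ 2), ENNReal.ofReal (s ^ k) *
        ‖heatSemigroup s (laplacian^[k + 1] (deltaRight f)) n‖ₑ ≤
      ∫⁻ s, ratioKernel (α - 1) (1 + |(n : ℝ)|) √s * gradNorm (2 * (k + 1) + 1) α p f s ∂dtOverT := by
  set x : ℝ := 1 + |(n : ℝ)| with hx
  have hx0 : 0 < x := by positivity
  have hmeas := measurable_gradNorm (l := 2 * (k + 1) + 1) (α := α) hp hf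
  rw [lintegral_dtOverT (fun s => ratioKernel (α - 1) x √s * gradNorm (2 * (k + 1) + 1) α p f s)
    (((measurable_ratioKernel _).comp (measurable_const.prodMk
      Real.continuous_sqrt.measurable)).mul hmeas), ← lintegral_const_mul' _ _ ENNReal.ofReal_ne_top]
  refine (setLIntegral_mono' measurableSet_Ioc fun s hs => ?_).trans
    (lintegral_mono_set Ioc_subset_Ioi_self)
  have hs0 : 0 < s := hs.1
  have hr0 : 0 < √s := Real.sqrt_pos.2 hs0
  have hsx : √s ≤ x := Real.sqrt_le_iff.2 ⟨hx0.le, hs.2⟩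
  rw [iterate_laplacian_deltaRight, heatSemigroup_translate, ratioKernel_comm,
    ratioKernel_of_le hr0 hsx, gradNorm, ← mul_assoc, ← mul_assoc, ← mul_assoc,
    ← ENNReal.ofReal_mul (by positivity), ← ENNReal.ofReal_mul (by positivity),
    ← ENNReal.ofReal_mul (by positivity)]
  refine mul_le_mul' (le_of_eq ?_) (enorm_le_eLpNorm_count _ _ (zero_lt_one.trans_le hp).ne')
  congr 1
  have h1 : √s ^ (α - 1) = s ^ ((α - 1) / 2) := by
    rw [Real.sqrt_eq_rpow, ← Real.rpow_mul hs0.le]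
    congr 1
    ring
  have h2 : s ^ ((((2 * (k + 1) + 1 : ℕ) : ℝ) - α) / 2) = s ^ (-((α - 1) / 2)) * s ^ k * s := by
    rw [← Real.rpow_natCast, ← Real.rpow_add hs0, ← Real.rpow_add_one hs0.ne']
    congr 1
    push_cast
    ring
  rw [Real.div_rpow hr0.le hx0.le, h1, h2, Real.rpow_neg hs0.le, Real.rpow_neg hx0.le]
  have := Real.rpow_pos_of_pos hs0 ((α - 1) / 2)
  have := Real.rpow_pos_of_pos hx0 (α - 1)
  field_simp

/-- The growth condition for `f ∈ Λ_H^α` passes to `δ_right f`, with `α` replaced by `α - 1`. -/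
theorem eLpNorm_growthFun_deltaRight {α : ℝ} (hα : 1 < α) {p q : ℝ≥0∞} (hp : 1 ≤ p) (hq : 1 ≤ q)
    {f : ℤ → ℝ} (h : eLpNorm (growthFun α f) q weightMeasure < ∞) {k : ℕ}
    (hk : besovNorm (2 * (k + 1) + 1) α p q f < ∞) :
    eLpNorm (growthFun (α - 1) (deltaRight f)) q weightMeasure < ∞ := by
  have hf := expGrowth_of_growthFun hq h
  have hmeas : ∀ g : ℤ → ℝ≥0∞, AEStronglyMeasurable g weightMeasure :=
    fun g => (StronglyMeasurable.of_discrete).aestronglyMeasurable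
  obtain ⟨C₁, hC₁, hschur₁⟩ := logSize_int.eLpNorm_le logSize_int one_pos
  obtain ⟨C₂, hC₂, hschur₂⟩ := logSize_int.eLpNorm_le logSize_sqrt (sub_pos.2 hα)
  choose C hC hterm using fun m => exists_taylor_term_le (α := α) (by linarith) m
  set Φ : ℤ → ℝ≥0∞ := fun n =>
    ∫⁻ j, ratioKernel 1 (1 + |(n : ℝ)|) (1 + |(j : ℝ)|) * growthFun α f j ∂weightMeasure with hΦ
  set Ψ : ℤ → ℝ≥0∞ := fun n => ∫⁻ s, ratioKernel (α - 1) (1 + |(n : ℝ)|) √s *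
    gradNorm (2 * (k + 1) + 1) α p f s ∂dtOverT with hΨ
  set A : ℝ≥0∞ := ∑ m ∈ Finset.range (k + 1), C m with hA
  have hAtop : A < ∞ := ENNReal.sum_lt_top.2 fun m _ => (hC m).lt_top
  have hbound : ∀ n, growthFun (α - 1) (deltaRight f) n ≤ A * Φ n + Ψ n := by
    intro n
    have hu : ∀ m s, HasDerivAt (fun s => heatSemigroup s (laplacian^[m] (deltaRight f)) n)
        (heatSemigroup s (laplacian^[m + 1] (deltaRight f)) n) s := fun m s => by
      rw [Function.iterate_succ_apply']
      exact (hf.deltaRight.iterate_laplacian m).hasDerivAt_heatSemigroup s n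
    have h1 := enorm_zero_le_taylor (u := fun m s => heatSemigroup s (laplacian^[m] (deltaRight f)) n)
      hu k (t := (1 + |(n : ℝ)|) ^ 2) (by positivity)
    simp only [Function.iterate_zero, id, hf.deltaRight.heatSemigroup_zero] at h1
    rw [growthFun]
    refine (mul_le_mul' le_rfl h1).trans ?_
    rw [mul_add, Finset.mul_sum, hA, Finset.sum_mul]
    exact add_le_add (Finset.sum_le_sum fun m _ => hterm m f hf n) (remainder_le hp hf k n)
  refine lt_of_le_of_lt (eLpNorm_mono_enorm (g := (fun n => A * Φ n) + Ψ) fun n => ?_)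
    ((eLpNorm_add_le (hmeas _) (hmeas _) hq).trans_lt (ENNReal.add_lt_top.2 ⟨?_, ?_⟩))
  · rw [enorm_eq_self, enorm_eq_self]
    exact hbound n
  · refine lt_of_le_of_lt (eLpNorm_le_mul_eLpNorm_of_ae_le_mul'' (c := A) q (hmeas Φ)
      (Filter.Eventually.of_forall fun n => ?_)) (ENNReal.mul_lt_top hAtop ?_)
    · rw [enorm_eq_self, enorm_eq_self]
    · exact (hschur₁ q hq _ measurable_from_top).trans_lt (ENNReal.mul_lt_top hC₁.lt_top h)
  · exact (hschur₂ q hq _ (measurable_gradNorm hp hf)).trans_lt (ENNReal.mul_lt_top hC₂.lt_top hk)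

/-! ### Reduction to difference seminorms and the conclusion -/

theorem mixedNorm_eq_besovNorm {f : ℤ → ℝ} (hf : ExpGrowth f) (k : ℕ) (β : ℝ) (p q : ℝ≥0∞) :
    mixedNorm p q (fun t n => t ^ ((k : ℝ) - β / 2) *
      iteratedDeriv k (fun s : ℝ => heatSemigroup s f n) t) = besovNorm (2 * k) β p q f := by
  rw [mixedNorm, besovNorm]
  refine eLpNorm_congr_ae ?_
  filter_upwards [ae_dtOverT_pos] with t ht
  have h1 : (fun n => t ^ ((k : ℝ) - β / 2) * iteratedDeriv k (fun s : ℝ => heatSemigroup s f n) t) =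
      t ^ ((k : ℝ) - β / 2) • translate (-k) (heatSemigroup t (deltaRight^[2 * k] f)) := by
    funext n
    rw [hf.iteratedDeriv_heatSemigroup, iterate_laplacian_eq, heatSemigroup_translate']
    rfl
  rw [h1, eLpNorm_const_smul, eLpNorm_translate, gradNorm, Real.enorm_of_nonneg (by positivity)]
  congr 3
  push_cast
  ring

theorem besovNorm_deltaRight (f : ℤ → ℝ) (l : ℕ) (α : ℝ) (p q : ℝ≥0∞) :
    besovNorm l (α - 1) p q (deltaRight f) = besovNorm (l + 1) α p q f := by
  unfold besovNorm gradNorm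
  simp only [Function.iterate_succ_apply]
  congr! 5
  push_cast
  ring_nf

theorem mem_LambdaH_iff {α : ℝ} (hα : 0 ≤ α) {p q : ℝ≥0∞} (hq : 1 ≤ q) {f : ℤ → ℝ} :
    f ∈ LambdaH α p q ↔ eLpNorm (growthFun α f) q weightMeasure < ∞ ∧
      besovNorm (2 * (⌊α / 2⌋₊ + 1)) α p q f < ∞ := by
  rw [LambdaH, mem_ofPred_eq, memLp_iff_growthFun hα]
  -- The growth condition comes first: it provides the exponential growth under which the time
  -- derivatives can be rewritten as differences.
  refine and_congr_right fun h => ?_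
  rw [mixedNorm_eq_besovNorm (expGrowth_of_growthFun hq h)]

end DiscreteBesov

theorem theorem3p9 (α : ℝ) (hα : 1 < α) (p q : ℝ≥0∞) (hp : 1 ≤ p) (hq : 1 ≤ q) (f : ℤ → ℝ) :
    f ∈ DiscreteBesov.LambdaH α p q ↔
      DiscreteBesov.deltaRight f ∈ DiscreteBesov.LambdaH (α - 1) p q := by
  open DiscreteBesov in
  have hα0 : 0 ≤ α := by linarith
  rw [mem_LambdaH_iff hα0 hq, mem_LambdaH_iff (by linarith) hq, besovNorm_deltaRight]
  set k := ⌊α / 2⌋₊ with hk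
  set k' := ⌊(α - 1) / 2⌋₊ with hk'
  have h1 : α < 2 * (k + 1 : ℕ) := by
    have := Nat.lt_floor_add_one (α / 2)
    push_cast
    linarith
  have h2 : α < 2 * (k' + 1 : ℕ) + 1 := by
    have := Nat.lt_floor_add_one ((α - 1) / 2)
    push_cast
    linarith
  have h3 : (k' : ℝ) ≤ (α - 1) / 2 := Nat.floor_le (by linarith)
  have h4 : (k : ℝ) ≤ α / 2 := Nat.floor_le (by linarith)
  -- The arguments α/2 and (α-1)/2 differ by 1/2. The two orders 2(k+1) and 2(k'+1)+1 are therefore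
  -- adjacent, in one order or the other.
  have hkk : k' = k ∨ k = k' + 1 := by
    have h5 : k' ≤ k := Nat.floor_mono (by linarith)
    have h6 : k < k' + 2 := by
      have : (k : ℝ) < (k' + 2 : ℕ) := by push_cast at h2 ⊢; linarith
      exact_mod_cast this
    omega
  constructor
  · rintro ⟨hg, hb⟩
    have hf := expGrowth_of_growthFun hq hg
    have hb1 := besovNorm_succ_lt_top hf hp hq hb
    refine ⟨eLpNorm_growthFun_deltaRight hα hp hq hg hb1, ?_⟩
    -- If k' = k, the seminorm `hb1` is already the required one. Otherwise its order 2(k'+1)+3 is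
    -- lowered by two, which stays above α.
    rcases hkk with h | h
    · rwa [h]
    · rw [h] at hb1
      have hl : α < (2 * (k' + 1) + 1 : ℕ) := by push_cast at h2 ⊢; exact h2
      exact besovNorm_lt_top_of_add_two hf hp hq hl
        (tendsto_heatSemigroup_iterate_deltaRight hα0 hq hg hl) hb1
  · rintro ⟨hg', hb⟩
    have hg := eLpNorm_growthFun_of_deltaRight (by linarith) hq hg'
    have hf := expGrowth_of_growthFun hq hg
    have hb1 := besovNorm_succ_lt_top hf hp hq hb
    refine ⟨hg, ?_⟩
    -- Now the roles are exchanged: for k' = k the order 2(k+1)+2 is lowered by two, and for k = k'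
    -- + 1 one added difference suffices.
    rcases hkk with h | h
    · rw [h] at hb1
      have hl : α < (2 * (k + 1) : ℕ) := by push_cast at h1 ⊢; exact h1
      exact besovNorm_lt_top_of_add_two hf hp hq hl
        (tendsto_heatSemigroup_iterate_deltaRight hα0 hq hg hl) hb1
    · rw [h]
      exact hb1
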